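/- **Setting.** Let $n,p\ge 1$, $\mu_I>0$, $L=(L_1,\dots,L_p)$ with all $L_j>0$, $L_{\min}=\min_j L_j$, $L_{\max}=\max_j L_j$. Put $\mathcal W=\prod_{j=1}^p[-\frac{L_j}{2\mu_I},\frac{L_j}{2\mu_I}]$ and $\mathcal X=\prod_{j=1}^p\{-\frac{L_j}{2\mu_I},\frac{L_j}{2\mu_I}\}$. For $d\in\mathcal X$ let $\ell(w;d)=\frac{\mu_I}{2}\|w-d\|_2^2$, and for a dataset $D=(d_1,\dots,d_n)\in\mathcal X^n$ consider the minimization over $w\in\mathbb R^p$ of $$F(w;D)=\frac1n\sum_{i=1}^n\ell(w;d_i)+i_{\mathcal W}(w),$$ where $i_{\mathcal W}$ is $0$ on $\mathcal W$ and $+\infty$ outside. A randomized algorithm $\mathcal A:\mathcal X^n\to\mathbb R^p$ is $(\epsilon,\delta)$-differentially private if $\Pr[\mathcal A(D)\in S]\le e^{\epsilon}\Pr[\mathcal A(D')\in S]+\delta$ for all measurable $S$ and all $D,D'$ that differ in at most one record. **(a)** For every $d\in\mathcal X$, the loss $\ell(\cdot;d)$ is $\mu_I$-strongly convex with respect to $\|\cdot\|_2$,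 and it is $L$-component-Lipschitz on $\mathcal W$: $|\ell(w+te_j;d)-\ell(w;d)|\le L_j|t|$ whenever $w,\,w+te_j\in\mathcal W$. The regularizer is separable: $i_{\mathcal W}(w)=\sum_j i_{[-L_j/(2\mu_I),\,L_j/(2\mu_I)]}(w_j)$. For every $D\in\mathcal X^n$, the unique minimizer of $F(\cdot;D)$ is $w^*=\frac1n\sum_{i=1}^n d_i\in\mathcal W$. There are absolute constants $c_0,c_1>0$ such that the following hold. **(b)** For every $\kappa>0$ there is a constant $c>0$ depending only on $\kappa$ such that, for all $n,p\ge1$, $\mu_I>0$, all $L$ with $\sqrt{\sum_{j\in\mathcal J}L_j^2}\ge\kappa\|L\|_2$ for every $\mathcal J\subseteq\{1,\dots,p\}$ of size at least $\lceil p/75\rceil$, all $0<\epsilon\le c_1\sqrt p$ and $0\le\delta\le c_0/n$, and every $(\epsilon,\delta)$-differentially private $\mathcal A:\mathcal X^n\to\mathbb R^p$, there is a dataset $D\in\mathcal X^n$ such that, with probability at least $1/3$ over $w^{priv}=\mathcal A(D)$, $$F(w^{priv};D)-F(w^*;D)\ \ge\ c\,\min\Big(\frac{\|L\|_2^2}{\mu_I},\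 \frac{p\,\|L\|_2^2}{\mu_I n^2\epsilon^2}\Big),$$ and the expectation of $F(w^{priv};D)-F(w^*;D)$ has the same lower bound. **(c)** Without the assumption on how the $L_j$ are spread, there is an absolute constant $c>0$ such that the conclusion of (b) holds for all $L$ with positive entries (the other hypotheses being the same) with the lower bound $$c\,\frac{L_{\min}^2}{L_{\max}^2}\,\min\Big(\frac{\|L\|_2^2}{\mu_I},\ \frac{p\,\|L\|_2^2}{\mu_I n^2\epsilon^2}\Big).$$ -/

import Mathlib

open MeasureTheory
open scoped ENNReal

noncomputable section

namespace DPLower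

/-- Two datasets of `n` records are neighboring if they differ on at most one record. -/
def Neighboring {X : Type*} {n : ℕ} (D D' : Fin n → X) : Prop :=
  {i | D i ≠ D' i}.Subsingleton

/-- A randomized algorithm, given by the law `A D` of its output on each dataset `D`, is
`(ε, δ)`-differentially private. -/
def IsDP {X Y : Type*} [MeasurableSpace Y] {n : ℕ}
    (A : (Fin n → X) → ProbabilityMeasure Y) (ε δ : ℝ) : Prop :=
  ∀ D D' : Fin n → X, Neighboring D D' → ∀ S : Set Y, MeasurableSet S →
    (A D : Measure Y) S
      ≤ ENNReal.ofReal (Real.exp ε) * (A D' : Measure Y) S + ENNReal.ofReal δ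

/-- `f` is differentiable and `μ`-strongly convex with respect to the Euclidean norm. -/
def IsStronglyConvex {p : ℕ} (μ : ℝ) (f : EuclideanSpace ℝ (Fin p) → ℝ) : Prop :=
  Differentiable ℝ f ∧ ∀ v w : EuclideanSpace ℝ (Fin p),
    f v + inner ℝ (gradient f v) (w - v) + μ / 2 * ‖w - v‖ ^ 2 ≤ f w

/-- `f` is `L`-component-Lipschitz on `s`: moving inside `s` by `t` along the `j`-th canonical
basis vector changes `f` by at most `L j * |t|`. -/
def ComponentLipschitzOn {p : ℕ} (L : EuclideanSpace ℝ (Fin p))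
    (f : EuclideanSpace ℝ (Fin p) → ℝ) (s : Set (EuclideanSpace ℝ (Fin p))) : Prop :=
  ∀ w ∈ s, ∀ (t : ℝ) (j : Fin p), w + EuclideanSpace.single j t ∈ s →
    |f (w + EuclideanSpace.single j t) - f w| ≤ L j * |t|

open Classical in
/-- The characteristic function of convex analysis: `0` on `s` and `+∞` outside `s`. -/
def charFn {α : Type*} (s : Set α) (x : α) : EReal := if x ∈ s then 0 else ⊤

/-- The one-dimensional interval `[-L_j / (2 μ), L_j / (2 μ)]`. -/
def side {p : ℕ} (μ : ℝ) (L : EuclideanSpace ℝ (Fin p)) (j : Fin p) : Set ℝ :=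
  Set.Icc (-(L j / (2 * μ))) (L j / (2 * μ))

/-- The box `∏ⱼ [-L_j / (2 μ), L_j / (2 μ)]`. -/
def box {p : ℕ} (μ : ℝ) (L : EuclideanSpace ℝ (Fin p)) : Set (EuclideanSpace ℝ (Fin p)) :=
  {w | ∀ j, w j ∈ side μ L j}

/-- The data universe `∏ⱼ {-L_j / (2 μ), L_j / (2 μ)}`. -/
def dataUniv {p : ℕ} (μ : ℝ) (L : EuclideanSpace ℝ (Fin p)) :
    Set (EuclideanSpace ℝ (Fin p)) :=
  {d | ∀ j, d j = L j / (2 * μ) ∨ d j = -(L j / (2 * μ))}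

/-- The quadratic loss `(μ / 2) ‖w - d‖²`. -/
def loss {p : ℕ} (μ : ℝ) (d w : EuclideanSpace ℝ (Fin p)) : ℝ := μ / 2 * ‖w - d‖ ^ 2

/-- The composite objective: the average of the losses over the dataset plus the characteristic
function of the box. -/
def objective {p n : ℕ} (μ : ℝ) (L : EuclideanSpace ℝ (Fin p)) (D : Fin n → dataUniv μ L)
    (w : EuclideanSpace ℝ (Fin p)) : EReal :=
  (((1 / (n : ℝ)) * ∑ i, loss μ (D i : EuclideanSpace ℝ (Fin p)) w : ℝ) : EReal)
    + charFn (box μ L) w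

/-- The mean of the records of the dataset. -/
def mean {p n : ℕ} {μ : ℝ} {L : EuclideanSpace ℝ (Fin p)} (D : Fin n → dataUniv μ L) :
    EuclideanSpace ℝ (Fin p) :=
  (1 / (n : ℝ)) • ∑ i, (D i : EuclideanSpace ℝ (Fin p))

/-- The excess risk of `w`: the objective at `w` minus the optimal value. -/
def excessRisk {p n : ℕ} (μ : ℝ) (L : EuclideanSpace ℝ (Fin p)) (D : Fin n → dataUniv μ L)
    (w : EuclideanSpace ℝ (Fin p)) : EReal :=
  objective μ L D w - ⨅ v, objective μ L D v

/-- On some dataset, the output of `A` has excess risk at least `r` with probability at least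
`1/3`, and its expected excess risk is at least `r`. -/
def RiskAtLeast {p n : ℕ} (μ : ℝ) (L : EuclideanSpace ℝ (Fin p))
    (A : (Fin n → dataUniv μ L) → ProbabilityMeasure (EuclideanSpace ℝ (Fin p)))
    (r : ℝ) : Prop :=
  ∃ D : Fin n → dataUniv μ L,
    (1 / 3 : ℝ≥0∞) ≤
      (A D : Measure (EuclideanSpace ℝ (Fin p))) {w | (r : EReal) ≤ excessRisk μ L D w} ∧
    ENNReal.ofReal r ≤
      ∫⁻ w, (excessRisk μ L D w).toENNReal ∂(A D : Measure (EuclideanSpace ℝ (Fin p)))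

/-- The rate `min (‖L‖₂² / μ, p ‖L‖₂² / (μ n² ε²))`. -/
def rate {p : ℕ} (n : ℕ) (μ : ℝ) (L : EuclideanSpace ℝ (Fin p)) (ε : ℝ) : ℝ :=
  min (‖L‖ ^ 2 / μ) (p * ‖L‖ ^ 2 / (μ * (n : ℝ) ^ 2 * ε ^ 2))

/-- Every set of at least `⌈p / 75⌉` coordinates carries at least a fraction `κ` of the
Euclidean norm of `L`. -/
def WellSpread {p : ℕ} (κ : ℝ) (L : EuclideanSpace ℝ (Fin p)) : Prop :=
  ∀ J : Finset (Fin p), ⌈(p : ℝ) / 75⌉₊ ≤ J.card → κ * ‖L‖ ≤ √(∑ j ∈ J, L j ^ 2)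

end DPLower

end

noncomputable section

namespace DPLower

/-! The excess risk of `w` is at least `μ / 2 * ‖w - mean D‖ ^ 2`, so the theorem is a lower bound
for private mean estimation on sign vectors, proved by a fingerprinting (score) argument.

Draw `P` uniformly from `[-1, 1]^p`, then `m` independent records `x i` of independent signs with
means `P`, and let `U` be the output of the mechanism, clipped to `[-1, 1]^p`. Consider the
expectation of `∑ i, ⟨U, x i - P⟩`. Privacy makes it small: `U` hardly changes when record `i` is
overwritten, and then `x i` is independent of `U`, so `⟨U, x i - P⟩` is centered with fluctuations
of order `√p`. Each record contributes at most `12 ε √p + 4 δ p` (`sum_dataWeight_mul_integral_le`).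
Accuracy makes it large: integration by parts against the prior turns it into the expectation of `2
⟨U, P⟩` (`integral_dataWeight_score`), of order `p` if `U` is usually close to the column means
(`integral_sum_mul_ge`). For `m ε ≤ √p / 1000` and `m δ ≤ 1 / 1000` these are incompatible
(`exists_measure_badCoords_ge`), so on some dataset, with probability at least `1/3`, a fraction
`1/75` of the columns is missed by a constant.

For general `n`, take `m` of order `min n (√p / ε)` and pad with `n - m` fixed records
(`exists_subsample_size`, `padded`). This scales the error by `m / n`, hence the risk by `(m / n) ^
2`, which is the rate. The spread of `L` converts missed columns into a fraction of `‖L‖ ^ 2`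
(`le_loss_of_card_badCoords`). -/

/-- The sign `±1` encoded by a Boolean. -/
def sgn (b : Bool) : ℝ := if b then 1 else -1

lemma sgn_true : sgn true = 1 := by simp [sgn]

lemma sgn_false : sgn false = -1 := by simp [sgn]

lemma abs_sgn (b : Bool) : |sgn b| = 1 := by cases b <;> simp [sgn]

/-- The probability of the sign vector `y` when its coordinates are independent with means `P`. -/
def recordWeight {κ : Type*} [Fintype κ] (P : κ → ℝ) (y : κ → Bool) : ℝ :=
  ∏ j, (1 + sgn (y j) * P j) / 2

/-- The probability of the dataset `x` when its records are independent with law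
`recordWeight P`. -/
def dataWeight {ι κ : Type*} [Fintype ι] [Fintype κ] (P : κ → ℝ) (x : ι → κ → Bool) : ℝ :=
  ∏ i, recordWeight P (x i)

/-! ### Product laws on sign vectors and datasets -/

section Weights

variable {ι κ : Type*} [Fintype ι] [DecidableEq ι] [Fintype κ] [DecidableEq κ]

omit [DecidableEq κ] in
lemma recordWeight_nonneg {P : κ → ℝ} (hP : ∀ j, |P j| ≤ 1) (y : κ → Bool) :
    0 ≤ recordWeight P y := by
  refine Finset.prod_nonneg fun j _ => ?_
  have := abs_le.1 (hP j)
  cases y j <;> simp [sgn] <;> linarith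

omit [DecidableEq ι] [DecidableEq κ] in
lemma dataWeight_nonneg {P : κ → ℝ} (hP : ∀ j, |P j| ≤ 1) (x : ι → κ → Bool) :
    0 ≤ dataWeight P x :=
  Finset.prod_nonneg fun i _ => recordWeight_nonneg hP (x i)

/-- Independence of the coordinates, by distributivity. Moments of one coordinate and exponential
moments of linear forms are both special cases. -/
lemma sum_recordWeight_mul_prod (P : κ → ℝ) (h : κ → Bool → ℝ) :
    ∑ y, recordWeight P y * ∏ j, h j (y j)
      = ∏ j, ((1 + P j) / 2 * h j true + (1 - P j) / 2 * h j false) := by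
  have := Finset.prod_univ_sum (fun _ : κ => (Finset.univ : Finset Bool))
    (fun j b => (1 + sgn b * P j) / 2 * h j b)
  rw [Fintype.piFinset_univ] at this
  simp only [recordWeight, ← Finset.prod_mul_distrib]
  rw [← this]
  refine Finset.prod_congr rfl fun j _ => ?_
  simp [sgn, sub_eq_add_neg]

lemma sum_recordWeight (P : κ → ℝ) : ∑ y, recordWeight P y = 1 := by
  have := sum_recordWeight_mul_prod P (fun _ _ => 1)
  simp only [Finset.prod_const_one, mul_one] at this
  rw [this]
  exact Finset.prod_eq_one fun j _ => by ring

lemma sum_recordWeight_mul_apply (P : κ → ℝ) (j : κ) (h : Bool → ℝ) :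
    ∑ y, recordWeight P y * h (y j) = (1 + P j) / 2 * h true + (1 - P j) / 2 * h false := by
  have := sum_recordWeight_mul_prod P (fun k b => if k = j then h b else 1)
  simp only [Finset.prod_ite_eq', Finset.mem_univ, if_true] at this
  rw [this, Finset.prod_eq_single j]
  · simp
  · intro k _ hk
    simp only [hk, if_false]
    ring
  · simp

lemma sum_recordWeight_mul_centered (P u : κ → ℝ) :
    ∑ y, recordWeight P y * ∑ j, u j * (sgn (y j) - P j) = 0 := by
  simp only [Finset.mul_sum]
  rw [Finset.sum_comm]
  refine Finset.sum_eq_zero fun j _ => ?_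
  rw [sum_recordWeight_mul_apply P j (fun b => u j * (sgn b - P j)), sgn_true, sgn_false]
  ring

/-- The exponential factorizes over the coordinates. In each factor `exp s ≤ 1 + s + s ^ 2` applies,
the linear term averages to zero and the quadratic one to at most `a ^ 2`, which gives `exp (a ^ 2)`
per coordinate. -/
lemma sum_recordWeight_mul_exp_le {P v : κ → ℝ} (hP : ∀ j, |P j| ≤ 1) {a : ℝ}
    (ha : a ≤ 1 / 2) (hv : ∀ j, |v j| ≤ a) (hcard : Fintype.card κ * a ^ 2 ≤ 1 / 4) :
    ∑ y, recordWeight P y * Real.exp (∑ j, v j * (sgn (y j) - P j)) ≤ 3 / 2 := by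
  simp only [Real.exp_sum]
  rw [sum_recordWeight_mul_prod P (fun j b => Real.exp (v j * (sgn b - P j)))]
  have quad : ∀ s : ℝ, |s| ≤ 1 → Real.exp s ≤ 1 + s + s ^ 2 := fun s hs => by
    have := (abs_le.1 (Real.abs_exp_sub_one_sub_id_le hs)).2
    linarith
  have key : ∀ j, (1 + P j) / 2 * Real.exp (v j * (sgn true - P j))
      + (1 - P j) / 2 * Real.exp (v j * (sgn false - P j)) ≤ Real.exp (a ^ 2) := by
    intro j
    obtain ⟨h1, h2⟩ := abs_le.1 (hP j)
    have hva := hv j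
    have bd : ∀ b, |v j * (sgn b - P j)| ≤ 1 := fun b => by
      rw [abs_mul]
      have h3 : |sgn b - P j| ≤ 2 := by
        have := hP j
        have := abs_sub (sgn b) (P j)
        rw [abs_sgn] at this
        linarith
      calc |v j| * |sgn b - P j| ≤ (1 / 2) * 2 :=
            mul_le_mul (hva.trans ha) h3 (abs_nonneg _) (by norm_num)
        _ = 1 := by norm_num
    have e1 := quad _ (bd true)
    have e2 := quad _ (bd false)
    rw [sgn_true] at e1 ⊢
    rw [sgn_false] at e2 ⊢
    have hvsq : v j ^ 2 ≤ a ^ 2 := by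
      rw [← sq_abs (v j)]
      exact pow_le_pow_left₀ (abs_nonneg _) hva 2
    have hv' : v j ^ 2 * (1 - P j ^ 2) ≤ a ^ 2 := by
      nlinarith [sq_nonneg (v j * P j)]
    have := Real.add_one_le_exp (a ^ 2)
    have m1 := mul_le_mul_of_nonneg_left e1 (by linarith : 0 ≤ (1 + P j) / 2)
    have m2 := mul_le_mul_of_nonneg_left e2 (by linarith : 0 ≤ (1 - P j) / 2)
    nlinarith
  calc _ ≤ ∏ _j : κ, Real.exp (a ^ 2) := by
        refine Finset.prod_le_prod (fun j _ => ?_) fun j _ => key j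
        obtain ⟨h1, h2⟩ := abs_le.1 (hP j)
        have := Real.exp_nonneg (v j * (sgn true - P j))
        have := Real.exp_nonneg (v j * (sgn false - P j))
        have : 0 ≤ (1 + P j) / 2 := by linarith
        have : 0 ≤ (1 - P j) / 2 := by linarith
        positivity
    _ = Real.exp (Fintype.card κ * a ^ 2) := by
        rw [Finset.prod_const, ← Real.exp_nat_mul]; rfl
    _ ≤ Real.exp (1 / 4) := Real.exp_le_exp.2 hcard
    _ ≤ 3 / 2 := by
        have := quad (1 / 4) (by rw [abs_of_nonneg] <;> norm_num)
        linarith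

omit [DecidableEq κ] in
-- The exchangeability behind resampling, stated without division because a record may have weight
-- zero when some `P j = ±1`.
lemma dataWeight_update_mul (P : κ → ℝ) (x : ι → κ → Bool) (i : ι) (y : κ → Bool) :
    dataWeight P (Function.update x i y) * recordWeight P (x i)
      = dataWeight P x * recordWeight P y := by
  unfold dataWeight
  rw [← Finset.mul_prod_erase _ _ (Finset.mem_univ i),
    ← Finset.mul_prod_erase _ (fun k => recordWeight P (x k)) (Finset.mem_univ i),
    Function.update_self]
  have : ∏ k ∈ Finset.univ.erase i, recordWeight P (Function.update x i y k)
      = ∏ k ∈ Finset.univ.erase i, recordWeight P (x k) :=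
    Finset.prod_congr rfl fun k hk => by
      rw [Function.update_of_ne (Finset.ne_of_mem_erase hk)]
  rw [this]
  ring

/-- A record is independent of the dataset in which it is overwritten. -/
lemma sum_dataWeight_resample (P : κ → ℝ) (i : ι) (y₀ : κ → Bool)
    (G : (κ → Bool) → (ι → κ → Bool) → ℝ) :
    ∑ x, dataWeight P x * G (x i) (Function.update x i y₀)
      = ∑ x, dataWeight P x * ∑ y, recordWeight P y * G y (Function.update x i y₀) := by
  have h1 : ∑ x, dataWeight P x * G (x i) (Function.update x i y₀)
      = ∑ z : (ι → κ → Bool) × (κ → Bool),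
        dataWeight P z.1 * recordWeight P z.2 * G (z.1 i) (Function.update z.1 i y₀) := by
    rw [Fintype.sum_prod_type]
    refine Finset.sum_congr rfl fun x _ => ?_
    simp only
    rw [← Finset.sum_mul, ← Finset.mul_sum, sum_recordWeight, mul_one]
  have h2 : ∑ x, dataWeight P x * ∑ y, recordWeight P y * G y (Function.update x i y₀)
      = ∑ z : (ι → κ → Bool) × (κ → Bool),
        dataWeight P z.1 * recordWeight P z.2 * G z.2 (Function.update z.1 i y₀) := by
    rw [Fintype.sum_prod_type]
    refine Finset.sum_congr rfl fun x _ => ?_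
    simp only [Finset.mul_sum, mul_assoc]
  rw [h1, h2]
  -- Both sides are now sums over a dataset and a spare record. Swapping record `i` with the spare
  -- one is an involution that preserves the joint weight and exchanges the two integrands.
  have inv : ∀ z : (ι → κ → Bool) × (κ → Bool),
      (Function.update (Function.update z.1 i z.2) i (z.1 i), Function.update z.1 i z.2 i) = z :=
    fun z => by simp
  refine Finset.sum_bij' (fun z _ => (Function.update z.1 i z.2, z.1 i))
    (fun z _ => (Function.update z.1 i z.2, z.1 i)) (fun _ _ => Finset.mem_univ _)
    (fun _ _ => Finset.mem_univ _) (fun z _ => inv z) (fun z _ => inv z) fun z _ => ?_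
  simp only [Function.update_idem]
  rw [dataWeight_update_mul]

lemma sum_dataWeight (P : κ → ℝ) : ∑ x : ι → κ → Bool, dataWeight P x = 1 := by
  have := Finset.prod_univ_sum (fun _ : ι => (Finset.univ : Finset (κ → Bool)))
    (fun _ y => recordWeight P y)
  rw [Fintype.piFinset_univ] at this
  simp only [dataWeight]
  rw [← this]
  exact Finset.prod_eq_one fun i _ => sum_recordWeight P

lemma sum_dataWeight_mul_sgn (P : κ → ℝ) (i : ι) (j : κ) :
    ∑ x : ι → κ → Bool, dataWeight P x * sgn (x i j) = P j := by
  rw [sum_dataWeight_resample P i (fun _ => true) (fun y _ => sgn (y j)),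
    sum_recordWeight_mul_apply P j sgn, sgn_true, sgn_false, ← Finset.sum_mul, sum_dataWeight]
  ring

end Weights

/-! ### From indistinguishable events to means of statistics -/

section Indistinguishable

variable {Y : Type*} [MeasurableSpace Y]

/-- The one-sided `(ε, δ)`-indistinguishability of two laws extends from events to functions with
values in `[0, K]`. -/
lemma integral_le_of_forall_measure_le {Q M : Measure Y} [IsProbabilityMeasure Q]
    [IsProbabilityMeasure M] {ε δ K : ℝ} (hδ : 0 ≤ δ) (hK : 0 ≤ K)
    (h : ∀ S, MeasurableSet S →
      Q S ≤ ENNReal.ofReal (Real.exp ε) * M S + ENNReal.ofReal δ)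
    {g : Y → ℝ} (hg : Measurable g) (h0 : ∀ y, 0 ≤ g y) (h1 : ∀ y, g y ≤ K) :
    ∫ y, g y ∂Q ≤ Real.exp ε * ∫ y, g y ∂M + δ * K := by
  have int : ∀ (μ : Measure Y) [IsProbabilityMeasure μ], Integrable g μ := fun μ _ =>
    Integrable.of_bound hg.aestronglyMeasurable K
      (ae_of_all _ fun y => by rw [Real.norm_eq_abs, abs_of_nonneg (h0 y)]; exact h1 y)
  -- Layer cake, cut off at `K` since higher level sets are empty: `δ` is then paid only over an
  -- interval of length `K`.
  have cake : ∀ μ : Measure Y, ∫⁻ y, ENNReal.ofReal (g y) ∂μ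
      = ∫⁻ t in Set.Ioc 0 K, μ {y | t ≤ g y} := by
    intro μ
    rw [lintegral_eq_lintegral_meas_le μ (ae_of_all _ h0) hg.aemeasurable,
      ← Set.Ioc_union_Ioi_eq_Ioi hK, lintegral_union measurableSet_Ioi Set.Ioc_disjoint_Ioi_same]
    have : ∫⁻ t in Set.Ioi K, μ {y | t ≤ g y} = 0 := by
      rw [setLIntegral_congr_fun (g := fun _ => 0) measurableSet_Ioi, lintegral_zero]
      intro t ht
      have : {y | t ≤ g y} = ∅ := by
        ext y
        simp only [Set.mem_ofPred_eq, Set.mem_empty_iff_false, iff_false, not_le]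
        exact (h1 y).trans_lt ht
      simp [this]
    rw [this, add_zero]
  have key : ENNReal.ofReal (∫ y, g y ∂Q)
      ≤ ENNReal.ofReal (Real.exp ε * ∫ y, g y ∂M + δ * K) := by
    have hM : 0 ≤ ∫ y, g y ∂M := integral_nonneg h0
    rw [ENNReal.ofReal_add (mul_nonneg (Real.exp_nonneg _) hM) (mul_nonneg hδ hK),
      ENNReal.ofReal_mul (Real.exp_nonneg _), ENNReal.ofReal_mul hδ,
      ofReal_integral_eq_lintegral_ofReal (int Q) (ae_of_all _ h0),
      ofReal_integral_eq_lintegral_ofReal (int M) (ae_of_all _ h0), cake, cake]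
    calc ∫⁻ t in Set.Ioc 0 K, Q {y | t ≤ g y}
        ≤ ∫⁻ t in Set.Ioc 0 K,
          (ENNReal.ofReal (Real.exp ε) * M {y | t ≤ g y} + ENNReal.ofReal δ) :=
          lintegral_mono fun t => h _ (measurableSet_le measurable_const hg)
      _ = _ := by
          rw [lintegral_add_right _ measurable_const,
            lintegral_const_mul' _ _ ENNReal.ofReal_ne_top, setLIntegral_const, Real.volume_Ioc,
            sub_zero]
  refine (ENNReal.ofReal_le_ofReal_iff ?_).1 key
  have hM : 0 ≤ ∫ y, g y ∂M := integral_nonneg h0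
  positivity

/-- A pointwise majorant which, integrated against a neighboring output law, dominates the mean of
a bounded statistic with scale `s`. -/
def statBound (s ε z : ℝ) : ℝ :=
  if ε ≤ 1 then
    Real.cosh ε * z + Real.sinh ε * (s * (Real.exp (s⁻¹ * z) + Real.exp (-(s⁻¹ * z))))
  else ε * s + s * Real.exp (s⁻¹ * z)

/-- Two regimes are needed because `ε` may be as large as a multiple of `√p`, where `exp ε` is
useless as a factor. The majorants are built from exponentials since these have computable moments
under product laws. -/
lemma integral_le_integral_statBound {Q M : Measure Y} [IsProbabilityMeasure Q]
    [IsProbabilityMeasure M] {ε δ K s : ℝ} (hε : 0 < ε) (hδ : 0 ≤ δ) (hK : 0 ≤ K) (hs : 0 < s)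
    (h : ∀ S, MeasurableSet S →
      Q S ≤ ENNReal.ofReal (Real.exp ε) * M S + ENNReal.ofReal δ)
    (h' : ∀ S, MeasurableSet S →
      M S ≤ ENNReal.ofReal (Real.exp ε) * Q S + ENNReal.ofReal δ)
    {Z : Y → ℝ} (hZ : Measurable Z) (hb : ∀ y, |Z y| ≤ K) :
    ∫ y, Z y ∂Q ≤ ∫ y, statBound s ε (Z y) ∂M + 2 * δ * K := by
  have ibd : ∀ (μ : Measure Y) [IsProbabilityMeasure μ] (f : ℝ → ℝ), Continuous f →
      Integrable (fun y => f (Z y)) μ := fun μ _ f hf => by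
    obtain ⟨C, hC⟩ := (isCompact_Icc (a := -K) (b := K)).exists_bound_of_continuousOn
      hf.continuousOn
    exact Integrable.of_bound (hf.measurable.comp hZ).aestronglyMeasurable C
      (ae_of_all _ fun y => hC _ (abs_le.1 (hb y)))
  -- Small `ε`: the positive part of `Z` grows by at most `exp ε`, the negative part shrinks by at
  -- most `exp (-ε)`. The combination is `cosh ε * Z + sinh ε * |Z|`, whose first term has mean zero
  -- for centered `Z`.
  by_cases h1 : ε ≤ 1
  · have hp := integral_le_of_forall_measure_le hδ hK h (g := fun y => max (Z y) 0)
      (by fun_prop) (fun y => le_max_right _ _) (fun y => max_le ((le_abs_self _).trans (hb y)) hK)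
    have hn := integral_le_of_forall_measure_le hδ hK h' (g := fun y => max (-Z y) 0)
      (by fun_prop) (fun y => le_max_right _ _)
      (fun y => max_le ((neg_le_abs _).trans (hb y)) hK)
    have split : ∫ y, Z y ∂Q = ∫ y, max (Z y) 0 ∂Q - ∫ y, max (-Z y) 0 ∂Q := by
      rw [← integral_sub (ibd Q (fun z => max z 0) (by fun_prop))
        (ibd Q (fun z => max (-z) 0) (by fun_prop))]
      refine integral_congr_ae (ae_of_all _ fun y => ?_)
      simp only
      rcases le_total 0 (Z y) with h | h
      · rw [max_eq_left h, max_eq_right (by linarith)]; ring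
      · rw [max_eq_right h, max_eq_left (by linarith)]; ring
    have hn' : Real.exp (-ε) * ∫ y, max (-Z y) 0 ∂M - δ * K ≤ ∫ y, max (-Z y) 0 ∂Q := by
      have := mul_le_mul_of_nonneg_left hn (Real.exp_nonneg (-ε))
      rw [mul_add, ← mul_assoc, ← Real.exp_add, neg_add_cancel, Real.exp_zero, one_mul] at this
      have e1 : Real.exp (-ε) ≤ 1 := Real.exp_le_one_iff.2 (by linarith)
      have := mul_le_mul_of_nonneg_right e1 (mul_nonneg hδ hK)
      linarith
    have main : Real.exp ε * ∫ y, max (Z y) 0 ∂M - Real.exp (-ε) * ∫ y, max (-Z y) 0 ∂M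
        ≤ ∫ y, statBound s ε (Z y) ∂M := by
      rw [← integral_const_mul, ← integral_const_mul,
        ← integral_sub ((ibd M (fun z => max z 0) (by fun_prop)).const_mul _)
          ((ibd M (fun z => max (-z) 0) (by fun_prop)).const_mul _)]
      refine integral_mono (((ibd M (fun z => max z 0) (by fun_prop)).const_mul _).sub
          ((ibd M (fun z => max (-z) 0) (by fun_prop)).const_mul _)) ?_ fun y => ?_
      · simp only [statBound, h1, if_true]
        exact ibd M (fun z => Real.cosh ε * z + Real.sinh ε *
          (s * (Real.exp (s⁻¹ * z) + Real.exp (-(s⁻¹ * z))))) (by fun_prop)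
      · simp only [statBound, h1, if_true]
        have hsinh : 0 ≤ Real.sinh ε := Real.sinh_nonneg_iff.2 hε.le
        have habs : |Z y| ≤ s * (Real.exp (s⁻¹ * Z y) + Real.exp (-(s⁻¹ * Z y))) := by
          have e : |Z y| = s * |s⁻¹ * Z y| := by
            rw [abs_mul, abs_of_pos (inv_pos.2 hs), mul_inv_cancel_left₀ hs.ne']
          rw [e]
          refine mul_le_mul_of_nonneg_left ?_ hs.le
          have a1 := Real.add_one_le_exp (s⁻¹ * Z y)
          have a2 := Real.add_one_le_exp (-(s⁻¹ * Z y))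
          have a3 := Real.exp_nonneg (s⁻¹ * Z y)
          have a4 := Real.exp_nonneg (-(s⁻¹ * Z y))
          exact abs_le.2 ⟨by linarith, by linarith⟩
        have hm := mul_le_mul_of_nonneg_left habs hsinh
        have : Real.exp ε * max (Z y) 0 - Real.exp (-ε) * max (-Z y) 0
            = Real.cosh ε * Z y + Real.sinh ε * |Z y| := by
          rw [Real.cosh_eq, Real.sinh_eq]
          rcases le_total 0 (Z y) with h | h
          · rw [max_eq_left h, max_eq_right (by linarith), abs_of_nonneg h]; ring
          · rw [max_eq_right h, max_eq_left (by linarith), abs_of_nonpos h]; ring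
        linarith
    rw [split]
    linarith
  -- Large `ε`: truncate at height `ε * s`. The excess is at most `s * exp (s⁻¹ * Z - ε)`, whose
  -- factor `exp (-ε)` cancels the privacy loss.
  · have hp := integral_le_of_forall_measure_le hδ hK h (g := fun y => max (Z y - ε * s) 0)
      (by fun_prop) (fun y => le_max_right _ _)
      (fun y => max_le (by have := (le_abs_self _).trans (hb y); nlinarith) hK)
    have i1 : ∫ y, Z y ∂Q ≤ ε * s + ∫ y, max (Z y - ε * s) 0 ∂Q := by
      have : ∫ y, (ε * s + max (Z y - ε * s) 0) ∂Q = ε * s + ∫ y, max (Z y - ε * s) 0 ∂Q := by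
        rw [integral_add (integrable_const _) (ibd Q (fun z => max (z - ε * s) 0) (by fun_prop))]
        simp
      rw [← this]
      refine integral_mono (ibd Q (fun z => z) (by fun_prop))
        (ibd Q (fun z => ε * s + max (z - ε * s) 0) (by fun_prop)) fun y => ?_
      have := le_max_left (Z y - ε * s) 0
      simp only
      linarith
    have i2 : ε * s + Real.exp ε * ∫ y, max (Z y - ε * s) 0 ∂M
        ≤ ∫ y, statBound s ε (Z y) ∂M := by
      simp only [statBound, h1, if_false]
      rw [integral_add (integrable_const _)
        (ibd M (fun z => s * Real.exp (s⁻¹ * z)) (by fun_prop)), ← integral_const_mul]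
      simp only [integral_const, probReal_univ, smul_eq_mul, one_mul]
      refine add_le_add le_rfl ?_
      refine integral_mono ((ibd M (fun z => max (z - ε * s) 0) (by fun_prop)).const_mul _)
        (ibd M (fun z => s * Real.exp (s⁻¹ * z)) (by fun_prop)) fun y => ?_
      simp only
      have e1 : Real.exp (s⁻¹ * Z y) = Real.exp ε * Real.exp (s⁻¹ * Z y - ε) := by
        rw [← Real.exp_add]; congr 1; ring
      rw [e1, mul_left_comm]
      refine mul_le_mul_of_nonneg_left (max_le ?_ (by positivity)) (Real.exp_nonneg _)
      have := mul_le_mul_of_nonneg_left (Real.add_one_le_exp (s⁻¹ * Z y - ε)) hs.le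
      have e2 : s * (s⁻¹ * Z y - ε + 1) = Z y - ε * s + s := by
        field_simp
      linarith
    nlinarith [mul_nonneg hδ hK]

end Indistinguishable

/-! ### Privacy bounds the correlation with each record -/

section Upper

lemma sinh_le_two_mul {ε : ℝ} (h0 : 0 ≤ ε) (h1 : ε ≤ 1) : Real.sinh ε ≤ 2 * ε := by
  have a := abs_le.1 (Real.abs_exp_sub_one_sub_id_le (by rwa [abs_of_nonneg h0] : |ε| ≤ 1))
  have b := Real.add_one_le_exp (-ε)
  rw [Real.sinh_eq]
  nlinarith [a.2]

variable {ι κ : Type*} [Fintype ι] [DecidableEq ι] [Fintype κ] [DecidableEq κ]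

/-- With `r` the square root of the dimension, the scale `2 * r` makes the exponential moments at
most `3 / 2`. For small `ε` the linear term vanishes and `sinh ε ≤ 2 * ε` leaves `12 * ε * r`; for
large `ε` the total `2 * ε * r + 3 * r` is absorbed using `ε > 1`. -/
lemma sum_recordWeight_mul_statBound_le [Nonempty κ] {P u : κ → ℝ} (hP : ∀ j, |P j| ≤ 1)
    (hu : ∀ j, |u j| ≤ 1) {ε : ℝ} (hε : 0 < ε) :
    ∑ y, recordWeight P y
        * statBound (2 * √(Fintype.card κ)) ε (∑ j, u j * (sgn (y j) - P j))
      ≤ 12 * (ε * √(Fintype.card κ)) := by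
  set r := √(Fintype.card κ : ℝ) with hr
  have hcard : (1 : ℝ) ≤ Fintype.card κ := by exact_mod_cast Fintype.card_pos
  have hr1 : 1 ≤ r := by rw [hr]; exact Real.one_le_sqrt.2 hcard
  have hrsq : r ^ 2 = Fintype.card κ := Real.sq_sqrt (by positivity)
  have expo : ∀ c : ℝ, |c| = (2 * r)⁻¹ →
      ∑ y, recordWeight P y * Real.exp (c * ∑ j, u j * (sgn (y j) - P j)) ≤ 3 / 2 := by
    intro c hc
    have := sum_recordWeight_mul_exp_le (P := P) (v := fun j => c * u j) hP
      (a := (2 * r)⁻¹) (by rw [inv_le_comm₀ (by positivity) (by norm_num)]; linarith)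
      (fun j => by
        rw [abs_mul, hc]
        exact mul_le_of_le_one_right (by positivity) (hu j))
      (by rw [← hrsq]; field_simp; norm_num)
    simpa only [Finset.mul_sum, mul_assoc] using this
  have e1 := expo (2 * r)⁻¹ (abs_of_pos (by positivity))
  have e2 := expo (-(2 * r)⁻¹) (by rw [abs_neg, abs_of_pos (by positivity)])
  have e0 := sum_recordWeight_mul_centered P u
  by_cases h1 : ε ≤ 1
  · have : ∑ y, recordWeight P y * statBound (2 * r) ε (∑ j, u j * (sgn (y j) - P j))
        = Real.cosh ε * ∑ y, recordWeight P y * ∑ j, u j * (sgn (y j) - P j)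
          + Real.sinh ε * (2 * r) *
            (∑ y, recordWeight P y * Real.exp ((2 * r)⁻¹ * ∑ j, u j * (sgn (y j) - P j))
            + ∑ y, recordWeight P y
              * Real.exp (-(2 * r)⁻¹ * ∑ j, u j * (sgn (y j) - P j))) := by
      rw [← Finset.sum_add_distrib, Finset.mul_sum, Finset.mul_sum, ← Finset.sum_add_distrib]
      refine Finset.sum_congr rfl fun y _ => ?_
      simp only [statBound, h1, if_true, neg_mul]
      ring
    rw [this, e0, mul_zero, zero_add]
    have hs := sinh_le_two_mul hε.le h1
    have hs0 : 0 ≤ Real.sinh ε := Real.sinh_nonneg_iff.2 hε.le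
    calc _ ≤ Real.sinh ε * (2 * r) * 3 :=
          mul_le_mul_of_nonneg_left (by linarith) (by positivity)
      _ ≤ 2 * ε * (2 * r) * 3 := by gcongr
      _ = 12 * (ε * r) := by ring
  · have : ∑ y, recordWeight P y * statBound (2 * r) ε (∑ j, u j * (sgn (y j) - P j))
        = ε * (2 * r) * ∑ y, recordWeight P y + 2 * r *
            ∑ y, recordWeight P y
              * Real.exp ((2 * r)⁻¹ * ∑ j, u j * (sgn (y j) - P j)) := by
      rw [Finset.mul_sum, Finset.mul_sum, ← Finset.sum_add_distrib]
      refine Finset.sum_congr rfl fun y _ => ?_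
      simp only [statBound, h1, if_false]
      ring
    rw [this, sum_recordWeight, mul_one]
    have := mul_le_mul_of_nonneg_left e1 (by positivity : 0 ≤ 2 * r)
    nlinarith

variable {Y : Type*} [MeasurableSpace Y]

/-- The mean, under a private mechanism, of the correlation of its output with a record. -/
lemma sum_dataWeight_mul_integral_le [Nonempty κ] (Q : (ι → κ → Bool) → Measure Y)
    [∀ x, IsProbabilityMeasure (Q x)] {ε δ : ℝ} (hε : 0 < ε) (hδ : 0 ≤ δ)
    (hQ : ∀ x x', (∃ i, ∀ k ≠ i, x k = x' k) → ∀ S, MeasurableSet S →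
      Q x S ≤ ENNReal.ofReal (Real.exp ε) * Q x' S + ENNReal.ofReal δ)
    {U : Y → κ → ℝ} (hU : Measurable U) (hU1 : ∀ y j, |U y j| ≤ 1)
    {P : κ → ℝ} (hP : ∀ j, |P j| ≤ 1) (i : ι) :
    ∑ x, dataWeight P x * ∫ y, ∑ j, U y j * (sgn (x i j) - P j) ∂Q x
      ≤ 12 * (ε * √(Fintype.card κ)) + 4 * δ * Fintype.card κ := by
  have hUj : ∀ j, Measurable fun y => U y j := fun j => (measurable_pi_apply j).comp hU
  have hZ : ∀ r : κ → Bool, Measurable fun y => ∑ j, U y j * (sgn (r j) - P j) := fun r =>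
    Finset.measurable_sum _ fun j _ => (hUj j).mul_const _
  have hb : ∀ (r : κ → Bool) y, |∑ j, U y j * (sgn (r j) - P j)| ≤ 2 * Fintype.card κ := by
    intro r y
    calc _ ≤ ∑ j, |U y j * (sgn (r j) - P j)| := Finset.abs_sum_le_sum_abs _ _
      _ ≤ ∑ _j : κ, (2 : ℝ) := Finset.sum_le_sum fun j _ => by
          rw [abs_mul]
          have h1 := abs_sub (sgn (r j)) (P j)
          rw [abs_sgn] at h1
          have := hP j
          calc _ ≤ 1 * (2 : ℝ) :=
                mul_le_mul (hU1 y j) (by linarith) (abs_nonneg _) zero_le_one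
            _ = 2 := one_mul _
      _ = 2 * Fintype.card κ := by simp [mul_comm]
  set s := 2 * √(Fintype.card κ : ℝ) with hs
  have hcard : (1 : ℝ) ≤ Fintype.card κ := by exact_mod_cast Fintype.card_pos
  have hspos : 0 < s := by
    have := Real.one_le_sqrt.2 hcard
    linarith
  let y₀ : κ → Bool := fun _ => true
  let G : (κ → Bool) → (ι → κ → Bool) → ℝ := fun r x =>
    ∫ y, statBound s ε (∑ j, U y j * (sgn (r j) - P j)) ∂Q x
  -- Compare with the dataset whose record `i` is overwritten by the fixed `y₀`. The statistic is
  -- bounded by `2 * Fintype.card κ`, whence the `δ` term.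
  have step : ∀ x, ∫ y, ∑ j, U y j * (sgn (x i j) - P j) ∂Q x
      ≤ G (x i) (Function.update x i y₀) + 4 * δ * Fintype.card κ := by
    intro x
    have := integral_le_integral_statBound hε hδ (by positivity) hspos
      (hQ x (Function.update x i y₀) ⟨i, fun k hk => by rw [Function.update_of_ne hk]⟩)
      (hQ (Function.update x i y₀) x ⟨i, fun k hk => by rw [Function.update_of_ne hk]⟩)
      (hZ (x i)) (hb (x i))
    linarith
  have hstat : Continuous (statBound s ε) := by
    unfold statBound
    split_ifs <;> fun_prop
  have hG : ∀ x, ∑ r, recordWeight P r * G r x ≤ 12 * (ε * √(Fintype.card κ)) := by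
    intro x
    have int : ∀ r : κ → Bool, Integrable
        (fun y => statBound s ε (∑ j, U y j * (sgn (r j) - P j))) (Q x) := fun r => by
      obtain ⟨C, hC⟩ := (isCompact_Icc (a := -(2 * Fintype.card κ : ℝ))
        (b := 2 * Fintype.card κ)).exists_bound_of_continuousOn hstat.continuousOn
      exact Integrable.of_bound (hstat.measurable.comp (hZ r)).aestronglyMeasurable C
        (ae_of_all _ fun y => hC _ (abs_le.1 (hb r y)))
    simp only [G, ← integral_const_mul]
    -- The output law no longer depends on `r`, so the record can be averaged first, for a fixed
    -- output `y`.
    rw [← integral_finsetSum _ fun r _ => (int r).const_mul _]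
    calc _ ≤ ∫ _y, 12 * (ε * √(Fintype.card κ)) ∂Q x :=
          integral_mono (integrable_finsetSum _ fun r _ => (int r).const_mul _)
            (integrable_const _) fun y => sum_recordWeight_mul_statBound_le hP (hU1 y) hε
      _ = _ := by simp
  calc _ ≤ ∑ x, dataWeight P x * (G (x i) (Function.update x i y₀) + 4 * δ * Fintype.card κ) :=
        Finset.sum_le_sum fun x _ => mul_le_mul_of_nonneg_left (step x) (dataWeight_nonneg hP x)
    _ = ∑ x, dataWeight P x * G (x i) (Function.update x i y₀) + 4 * δ * Fintype.card κ := by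
        simp only [mul_add, Finset.sum_add_distrib]
        rw [← Finset.sum_mul, sum_dataWeight, one_mul]
    _ ≤ _ := by
        rw [sum_dataWeight_resample]
        refine add_le_add_left ?_ _
        calc _ ≤ ∑ x, dataWeight P x * (12 * (ε * √(Fintype.card κ))) :=
              Finset.sum_le_sum fun x _ =>
                mul_le_mul_of_nonneg_left (hG _) (dataWeight_nonneg hP x)
          _ = _ := by rw [← Finset.sum_mul, sum_dataWeight, one_mul]

end Upper

/-! ### The uniform prior and the score identity -/

/-- The uniform distribution on `[-1, 1]`. -/
def unif : Measure ℝ := (2⁻¹ : ℝ≥0∞) • volume.restrict (Set.Icc (-1) 1)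

instance : IsProbabilityMeasure unif := by
  constructor
  simp only [unif, Measure.smul_apply, Measure.restrict_apply MeasurableSet.univ, Set.univ_inter,
    Real.volume_Icc, smul_eq_mul]
  norm_num
  exact ENNReal.inv_mul_cancel (by norm_num) (by norm_num)

lemma integral_unif (f : ℝ → ℝ) : ∫ t, f t ∂unif = (∫ t in (-1 : ℝ)..1, f t) / 2 := by
  rw [unif, integral_smul_measure, integral_Icc_eq_integral_Ioc,
    ← intervalIntegral.integral_of_le (by norm_num)]
  simp [div_eq_inv_mul]

lemma ae_unif_abs_le : ∀ᵐ t ∂unif, |t| ≤ 1 := by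
  have : ∀ᵐ t ∂(volume.restrict (Set.Icc (-1 : ℝ) 1)), |t| ≤ 1 := by
    filter_upwards [ae_restrict_mem measurableSet_Icc] with t ht using abs_le.2 ht
  exact Measure.ae_smul_measure this _

lemma integral_unif_sq : ∫ t, t ^ 2 ∂unif = 1 / 3 := by
  rw [integral_unif, integral_pow]
  norm_num

lemma integral_unif_abs : ∫ t, |t| ∂unif = 1 / 2 := by
  rw [integral_unif, ← intervalIntegral.integral_add_adjacent_intervals (b := 0)
    (continuous_abs.intervalIntegrable _ _) (continuous_abs.intervalIntegrable _ _)]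
  have h1 : ∫ t in (-1 : ℝ)..0, |t| = ∫ t in (-1 : ℝ)..0, -t :=
    intervalIntegral.integral_congr fun t ht => by
      rw [Set.uIcc_of_le (by norm_num)] at ht
      exact abs_of_nonpos ht.2
  have h2 : ∫ t in (0 : ℝ)..1, |t| = ∫ t in (0 : ℝ)..1, t :=
    intervalIntegral.integral_congr fun t ht => by
      rw [Set.uIcc_of_le (by norm_num)] at ht
      exact abs_of_nonneg ht.1
  rw [h1, h2, intervalIntegral.integral_neg, integral_id, integral_id]
  norm_num

/-- The score identity for one coordinate: under the uniform prior, the posterior mean of the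
centered sum of the signs is twice that of their mean. -/
lemma integral_unif_score {ι : Type*} [Fintype ι] [DecidableEq ι] (b : ι → Bool) :
    ∫ t, (∏ i, (1 + sgn (b i) * t) / 2) * (∑ i, (sgn (b i) - t) - 2 * t) ∂unif = 0 := by
  -- The integrand is the derivative of the likelihood times `1 - t ^ 2`, which vanishes at both
  -- endpoints. It rests on `(1 - t ^ 2) * s = (1 + s * t) * (s - t)` for `s = ±1`.
  have deriv : ∀ t : ℝ, HasDerivAt (fun t => (1 - t ^ 2) * ∏ i, (1 + sgn (b i) * t) / 2)
      ((∏ i, (1 + sgn (b i) * t) / 2) * (∑ i, (sgn (b i) - t) - 2 * t)) t := by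
    intro t
    have h1 : HasDerivAt (fun t : ℝ => 1 - t ^ 2) (-(2 * t)) t := by
      simpa using (hasDerivAt_pow 2 t).const_sub 1
    have h2 : HasDerivAt (fun t => ∏ i, (1 + sgn (b i) * t) / 2)
        (∑ i, (∏ k ∈ Finset.univ.erase i, (1 + sgn (b k) * t) / 2) • (sgn (b i) / 2)) t := by
      refine HasDerivAt.fun_finsetProd fun i _ => ?_
      have := (((hasDerivAt_id t).const_mul (sgn (b i))).const_add 1).div_const 2
      simpa using this
    refine (h1.mul h2).congr_deriv ?_
    have h3 : ∀ i, (1 - t ^ 2) *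
        ((∏ k ∈ Finset.univ.erase i, (1 + sgn (b k) * t) / 2) • (sgn (b i) / 2))
        = (∏ i, (1 + sgn (b i) * t) / 2) * (sgn (b i) - t) := by
      intro i
      rw [← Finset.mul_prod_erase _ _ (Finset.mem_univ i), smul_eq_mul]
      cases b i <;> simp only [sgn_true, sgn_false] <;> ring
    rw [Finset.mul_sum, Finset.sum_congr rfl fun i _ => h3 i, ← Finset.mul_sum]
    ring
  rw [integral_unif, intervalIntegral.integral_eq_sub_of_hasDerivAt (fun t _ => deriv t)
    (Continuous.intervalIntegrable (by fun_prop) _ _)]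
  norm_num

section Cube

variable {ι κ : Type*} [Fintype ι] [DecidableEq ι] [Fintype κ] [DecidableEq κ]

/-- The uniform distribution on the cube `[-1, 1]^κ`. -/
def unifCube (κ : Type*) [Fintype κ] : Measure (κ → ℝ) := Measure.pi fun _ => unif

instance : IsProbabilityMeasure (unifCube κ) := by unfold unifCube; infer_instance

omit [DecidableEq κ] in
lemma ae_unifCube : ∀ᵐ P ∂unifCube κ, ∀ j, |P j| ≤ 1 :=
  ae_all_iff.2 fun j =>
    (measurePreserving_eval (fun _ : κ => unif) j).quasiMeasurePreserving.ae ae_unif_abs_le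

omit [DecidableEq κ] in
lemma integrable_unifCube {f : (κ → ℝ) → ℝ} (hf : Continuous f) :
    Integrable f (unifCube κ) := by
  obtain ⟨C, hC⟩ := (isCompact_univ_pi fun _ : κ => isCompact_Icc (a := (-1 : ℝ))
    (b := 1)).exists_bound_of_continuousOn hf.continuousOn
  refine Integrable.of_bound hf.aestronglyMeasurable C ?_
  filter_upwards [ae_unifCube] with P hP
  exact hC P fun j _ => abs_le.1 (hP j)

omit [DecidableEq κ] in
lemma integral_unifCube_apply {f : ℝ → ℝ} (hf : Continuous f) (j : κ) :
    ∫ P, f (P j) ∂unifCube κ = ∫ t, f t ∂unif :=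
  integral_comp_eval (μ := fun _ : κ => unif) hf.aestronglyMeasurable

omit [DecidableEq ι] [DecidableEq κ] in
lemma continuous_dataWeight (x : ι → κ → Bool) : Continuous fun P => dataWeight P x := by
  unfold dataWeight recordWeight
  fun_prop

/-- The score identity: given the dataset, the centered sum of the records has posterior mean
twice that of the mean. -/
lemma integral_dataWeight_score (x : ι → κ → Bool) (j : κ) :
    ∫ P, dataWeight P x * ∑ i, (sgn (x i j) - P j) ∂unifCube κ
      = ∫ P, dataWeight P x * (2 * P j) ∂unifCube κ := by
  have hW := continuous_dataWeight x
  rw [← sub_eq_zero, ← integral_sub (integrable_unifCube (by fun_prop))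
    (integrable_unifCube (by fun_prop))]
  -- The difference factorizes over the columns, and the factor of column `j` integrates to zero by
  -- the one-dimensional identity.
  have : ∀ P : κ → ℝ, dataWeight P x * ∑ i, (sgn (x i j) - P j) - dataWeight P x * (2 * P j)
      = ∏ k, ((∏ i, (1 + sgn (x i k) * P k) / 2)
        * if k = j then ∑ i, (sgn (x i k) - P k) - 2 * P k else 1) := by
    intro P
    rw [Finset.prod_mul_distrib, Finset.prod_ite_eq', if_pos (Finset.mem_univ j),
      Finset.prod_comm, ← mul_sub]
    rfl
  simp only [this]
  rw [unifCube, integral_fintype_prod_eq_prod (f := fun k t =>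
    (∏ i, (1 + sgn (x i k) * t) / 2) * if k = j then ∑ i, (sgn (x i k) - t) - 2 * t else 1)]
  refine Finset.prod_eq_zero (Finset.mem_univ j) ?_
  simp only [if_true]
  exact integral_unif_score fun i => x i j

end Cube

/-! ### The fingerprinting contradiction -/

section Core

variable {ι κ : Type*} [Fintype ι] [DecidableEq ι] [Fintype κ] [DecidableEq κ]
  {Y : Type*} [MeasurableSpace Y]

/-- The mean of the signs in column `j` of a dataset. -/
def colMean (x : ι → κ → Bool) (j : κ) : ℝ := (∑ i, sgn (x i j)) / Fintype.card ι

omit [DecidableEq ι] [Fintype κ] [DecidableEq κ] in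
lemma abs_colMean_le (x : ι → κ → Bool) (j : κ) : |colMean x j| ≤ 1 := by
  unfold colMean
  rw [abs_div, Nat.abs_cast]
  refine div_le_one_of_le₀ ?_ (Nat.cast_nonneg _)
  calc _ ≤ ∑ i, |sgn (x i j)| := Finset.abs_sum_le_sum_abs _ _
    _ = _ := by simp [abs_sgn]

lemma sum_dataWeight_mul_colMean [Nonempty ι] (P : κ → ℝ) (j : κ) :
    ∑ x : ι → κ → Bool, dataWeight P x * colMean x j = P j := by
  have hm : (Fintype.card ι : ℝ) ≠ 0 := by exact_mod_cast Fintype.card_ne_zero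
  have : ∀ x : ι → κ → Bool, dataWeight P x * colMean x j
      = (∑ i, dataWeight P x * sgn (x i j)) / Fintype.card ι := fun x => by
    rw [colMean, ← Finset.mul_sum, mul_div_assoc]
  simp only [this]
  rw [← Finset.sum_div, Finset.sum_comm, Finset.sum_congr rfl fun i _ => sum_dataWeight_mul_sgn P i j]
  simp [hm]

/-- The coordinates in which `u` is not within `β` of the column means of `x`. -/
def badCoords (β : ℝ) (x : ι → κ → Bool) (u : κ → ℝ) : Finset κ :=
  {j | β < |u j - colMean x j|}

omit [DecidableEq ι] [DecidableEq κ] in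
lemma measurableSet_badCoords {U : Y → κ → ℝ} (hU : Measurable U) (β c : ℝ)
    (x : ι → κ → Bool) :
    MeasurableSet {y | c ≤ ((badCoords β x (U y)).card : ℝ)} := by
  have : Measurable fun y => ((badCoords β x (U y)).card : ℝ) := by
    simp only [badCoords, Finset.card_filter, Nat.cast_sum]
    refine Finset.measurable_sum _ fun j _ => ?_
    refine (measurable_from_top (f := fun n : ℕ => (n : ℝ))).comp ?_
    refine Measurable.ite ?_ measurable_const measurable_const
    exact measurableSet_lt measurable_const
      ((((measurable_pi_apply j).comp hU).sub_const _).abs)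
  exact measurableSet_le measurable_const this

omit [DecidableEq ι] [DecidableEq κ] in
-- Replacing `u j` by the column mean costs at most `β` in a good coordinate and at most `2` in a
-- bad one.
lemma sum_mul_ge_of_card_badCoords_lt {β : ℝ} (hβ : 0 ≤ β) {x : ι → κ → Bool} {u P : κ → ℝ}
    (hu : ∀ j, |u j| ≤ 1) (hP : ∀ j, |P j| ≤ 1) {c : ℝ}
    (h : ((badCoords β x u).card : ℝ) ≤ c) :
    ∑ j, colMean x j * P j - (Fintype.card κ * β + 2 * c) ≤ ∑ j, u j * P j := by
  have : ∑ j, (colMean x j * P j - (β + 2 * if β < |u j - colMean x j| then 1 else 0))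
      ≤ ∑ j, u j * P j := by
    refine Finset.sum_le_sum fun j _ => ?_
    have h1 : |(u j - colMean x j) * P j| ≤ |u j - colMean x j| := by
      rw [abs_mul]
      exact mul_le_of_le_one_right (abs_nonneg _) (hP j)
    have h2 := (abs_le.1 h1).1
    have h3 : |u j - colMean x j| ≤ 2 := by
      have := abs_sub (u j) (colMean x j)
      have := abs_colMean_le x j
      have := hu j
      linarith
    split_ifs with hc
    · linarith
    · have := not_lt.1 hc
      linarith
  rw [Finset.sum_sub_distrib, Finset.sum_add_distrib, ← Finset.mul_sum, Finset.sum_boole] at this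
  simp only [Finset.sum_const, Finset.card_univ, nsmul_eq_mul] at this
  have e : ((Finset.univ.filter fun j => β < |u j - colMean x j|).card : ℝ)
      = (badCoords β x u).card := rfl
  rw [e] at this
  linarith

omit [DecidableEq ι] [DecidableEq κ] in
/-- The correlation of an often accurate output with the parameter `P`. -/
lemma integral_sum_mul_ge (μ : Measure Y) [IsProbabilityMeasure μ]
    {U : Y → κ → ℝ} (hU : Measurable U) (hU1 : ∀ y j, |U y j| ≤ 1) {β c : ℝ} (hβ : 0 ≤ β)
    (hc : 0 ≤ c) {x : ι → κ → Bool} {P : κ → ℝ} (hP : ∀ j, |P j| ≤ 1)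
    (hF : μ {y | c ≤ ((badCoords β x (U y)).card : ℝ)} ≤ 1 / 3) :
    2 / 3 * ∑ j, colMean x j * P j - 1 / 3 * ∑ j, |P j| - (Fintype.card κ * β + 2 * c)
      ≤ ∑ j, (∫ y, U y j ∂μ) * P j := by
  set F := {y | c ≤ ((badCoords β x (U y)).card : ℝ)} with hFdef
  have hFm : MeasurableSet F := measurableSet_badCoords hU β c x
  have hUj : ∀ j, Measurable fun y => U y j := fun j => (measurable_pi_apply j).comp hU
  have hUi : ∀ j, Integrable (fun y => U y j) μ := fun j =>
    Integrable.of_bound (hUj j).aestronglyMeasurable 1 (ae_of_all _ fun y => hU1 y j)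
  set T := ∑ j, colMean x j * P j with hT
  set N := ∑ j, |P j| with hN
  set g := Fintype.card κ * β + 2 * c with hg
  have hg0 : 0 ≤ g := by positivity
  have hTN : 0 ≤ T + N := by
    rw [hT, hN, ← Finset.sum_add_distrib]
    refine Finset.sum_nonneg fun j _ => ?_
    have h1 : |colMean x j * P j| ≤ |P j| := by
      rw [abs_mul]
      exact mul_le_of_le_one_left (abs_nonneg _) (abs_colMean_le x j)
    linarith [(abs_le.1 h1).1]
  -- On the failure event `F` only the trivial bound `-N` is available. Since `T + N ≥ 0`, the
  -- expected loss is largest when `F` has measure `1 / 3`.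
  have pt : ∀ y, T - g - F.indicator (fun _ => T + N) y ≤ ∑ j, U y j * P j := by
    intro y
    by_cases hy : y ∈ F
    · rw [Set.indicator_of_mem hy]
      have : -N ≤ ∑ j, U y j * P j := by
        rw [hN, ← Finset.sum_neg_distrib]
        refine Finset.sum_le_sum fun j _ => ?_
        have h1 : |U y j * P j| ≤ |P j| := by
          rw [abs_mul]
          exact mul_le_of_le_one_left (abs_nonneg _) (hU1 y j)
        exact (abs_le.1 h1).1
      linarith
    · rw [Set.indicator_of_notMem hy]
      have := sum_mul_ge_of_card_badCoords_lt hβ (hU1 y) hP (not_le.1 hy).le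
      linarith
  have i1 : ∑ j, (∫ y, U y j ∂μ) * P j = ∫ y, ∑ j, U y j * P j ∂μ := by
    rw [integral_finsetSum _ fun j _ => (hUi j).mul_const _]
    exact Finset.sum_congr rfl fun j _ => (integral_mul_const _ _).symm
  have i2 : ∫ y, (T - g - F.indicator (fun _ => T + N) y) ∂μ = T - g - μ.real F * (T + N) := by
    rw [integral_sub (integrable_const _) ((integrable_const _).indicator hFm),
      integral_indicator hFm]
    simp
  have i3 : μ.real F ≤ 1 / 3 := by
    have := ENNReal.toReal_mono (by norm_num) hF
    simpa [Measure.real] using this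
  have i4 := integral_mono (μ := μ)
    ((integrable_const _).sub ((integrable_const (T + N)).indicator hFm))
    (integrable_finsetSum _ fun j _ => (hUi j).mul_const (P j)) pt
  have i5 : T - g - μ.real F * (T + N) ≤ ∫ y, ∑ j, U y j * P j ∂μ := by
    rw [← i2]; exact i4
  rw [i1]
  have := mul_le_mul_of_nonneg_right i3 hTN
  linarith

/-- A private mechanism with few records, seen through bounded statistics `U`, is inaccurate with
probability at least `1/3`, on some dataset, in a constant fraction of the columns. -/
theorem exists_measure_badCoords_ge [Nonempty ι] [Nonempty κ] (Q : (ι → κ → Bool) → Measure Y)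
    [∀ x, IsProbabilityMeasure (Q x)] {ε δ : ℝ} (hε : 0 < ε) (hδ : 0 ≤ δ)
    (hιε : Fintype.card ι * ε ≤ √(Fintype.card κ) / 1000) (hιδ : Fintype.card ι * δ ≤ 1 / 1000)
    (hQ : ∀ x x', (∃ i, ∀ k ≠ i, x k = x' k) → ∀ S, MeasurableSet S →
      Q x S ≤ ENNReal.ofReal (Real.exp ε) * Q x' S + ENNReal.ofReal δ)
    {U : Y → κ → ℝ} (hU : Measurable U) (hU1 : ∀ y j, |U y j| ≤ 1) :
    ∃ x, 1 / 3 ≤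
      Q x {y | (Fintype.card κ : ℝ) / 75 ≤ ((badCoords (1 / 100) x (U y)).card : ℝ)} := by
  by_contra! hcon
  set p : ℝ := (Fintype.card κ : ℝ) with hp
  have hp0 : 0 < p := by rw [hp]; exact_mod_cast Fintype.card_pos
  let f : (ι → κ → Bool) → κ → ℝ := fun x j => ∫ y, U y j ∂Q x
  have hUi : ∀ x j, Integrable (fun y => U y j) (Q x) := fun x j =>
    Integrable.of_bound ((measurable_pi_apply j).comp hU).aestronglyMeasurable 1
      (ae_of_all _ fun y => hU1 y j)
  have hcont : ∀ x : ι → κ → Bool, Continuous fun P : κ → ℝ => dataWeight P x :=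
    continuous_dataWeight
  -- Given the dataset, the mean output `f x` does not depend on `P`, so the score identity applies
  -- column by column.
  have score : ∫ P, ∑ x, dataWeight P x * ∑ j, f x j * ∑ i, (sgn (x i j) - P j) ∂unifCube κ
      = ∫ P, ∑ x, dataWeight P x * ∑ j, f x j * (2 * P j) ∂unifCube κ := by
    rw [integral_finsetSum _ fun x _ => integrable_unifCube (by fun_prop),
      integral_finsetSum _ fun x _ => integrable_unifCube (by fun_prop)]
    refine Finset.sum_congr rfl fun x _ => ?_
    simp only [Finset.mul_sum (Finset.univ : Finset κ)]
    rw [integral_finsetSum _ fun j _ => integrable_unifCube (by fun_prop),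
      integral_finsetSum _ fun j _ => integrable_unifCube (by fun_prop)]
    refine Finset.sum_congr rfl fun j _ => ?_
    simp only [mul_left_comm _ (f x j)]
    rw [integral_const_mul, integral_const_mul, integral_dataWeight_score]
  have upper : ∫ P, ∑ x, dataWeight P x * ∑ j, f x j * ∑ i, (sgn (x i j) - P j) ∂unifCube κ
      ≤ 16 / 1000 * p := by
    have : ∀ P : κ → ℝ, (∀ j, |P j| ≤ 1) →
        ∑ x, dataWeight P x * ∑ j, f x j * ∑ i, (sgn (x i j) - P j) ≤ 16 / 1000 * p := by
      intro P hP
      have e : ∑ x, dataWeight P x * ∑ j, f x j * ∑ i, (sgn (x i j) - P j)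
          = ∑ i, ∑ x, dataWeight P x * ∫ y, ∑ j, U y j * (sgn (x i j) - P j) ∂Q x := by
        rw [Finset.sum_comm]
        refine Finset.sum_congr rfl fun x _ => ?_
        rw [← Finset.mul_sum]
        congr 1
        simp only [Finset.mul_sum]
        rw [Finset.sum_comm]
        refine Finset.sum_congr rfl fun i _ => ?_
        rw [integral_finsetSum _ fun j _ => (hUi x j).mul_const _]
        exact Finset.sum_congr rfl fun j _ => (integral_mul_const _ _).symm
      rw [e]
      calc _ ≤ ∑ _i : ι, (12 * (ε * √p) + 4 * δ * p) :=
            Finset.sum_le_sum fun i _ => sum_dataWeight_mul_integral_le Q hε hδ hQ hU hU1 hP i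
        _ = 12 * (Fintype.card ι * ε) * √p + 4 * (Fintype.card ι * δ) * p := by
            rw [Finset.sum_const, Finset.card_univ, nsmul_eq_mul]; ring
        _ ≤ 12 * (√p / 1000) * √p + 4 * (1 / 1000) * p := by gcongr
        _ = 16 / 1000 * p := by
            have := Real.mul_self_sqrt hp0.le
            linear_combination 12 / 1000 * this
    calc _ ≤ ∫ _P, 16 / 1000 * p ∂unifCube κ := by
          refine integral_mono_ae (integrable_unifCube (by fun_prop)) (integrable_const _) ?_
          filter_upwards [ae_unifCube] with P hP using this P hP
      _ = _ := by simp
  -- The prior has `E[t ^ 2] = 1 / 3` and `E|t| = 1 / 2`, which yields `4/9 - 1/3 - 2 * (1/100 +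
  -- 2/75) = 17/450 > 37/1000` per column, against `16/1000` from privacy.
  have lower : 37 / 1000 * p
      ≤ ∫ P, ∑ x, dataWeight P x * ∑ j, f x j * (2 * P j) ∂unifCube κ := by
    have : ∀ P : κ → ℝ, (∀ j, |P j| ≤ 1) →
        4 / 3 * ∑ j, P j ^ 2 - 2 / 3 * ∑ j, |P j| - 2 * (p * (1 / 100) + 2 * (p / 75))
          ≤ ∑ x, dataWeight P x * ∑ j, f x j * (2 * P j) := by
      intro P hP
      have pt : ∀ x, 2 * (2 / 3 * ∑ j, colMean x j * P j - 1 / 3 * ∑ j, |P j|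
          - (p * (1 / 100) + 2 * (p / 75))) ≤ ∑ j, f x j * (2 * P j) := by
        intro x
        have := integral_sum_mul_ge (Q x) hU hU1 (by norm_num) (by positivity) hP (hcon x).le
        have e : ∑ j, f x j * (2 * P j) = 2 * ∑ j, f x j * P j := by
          rw [Finset.mul_sum]
          exact Finset.sum_congr rfl fun j _ => by ring
        rw [e]
        exact mul_le_mul_of_nonneg_left this (by norm_num)
      have e1 : ∑ x : ι → κ → Bool, dataWeight P x * ∑ j, colMean x j * P j = ∑ j, P j ^ 2 := by
        simp only [Finset.mul_sum]
        rw [Finset.sum_comm]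
        refine Finset.sum_congr rfl fun j _ => ?_
        simp only [← mul_assoc]
        rw [← Finset.sum_mul, sum_dataWeight_mul_colMean, sq]
      have e2 : ∑ x : ι → κ → Bool, dataWeight P x *
          (2 * (2 / 3 * ∑ j, colMean x j * P j - 1 / 3 * ∑ j, |P j|
            - (p * (1 / 100) + 2 * (p / 75))))
          = 4 / 3 * ∑ x : ι → κ → Bool, dataWeight P x * ∑ j, colMean x j * P j
            - (2 / 3 * ∑ j, |P j| + 2 * (p * (1 / 100) + 2 * (p / 75)))
              * ∑ x : ι → κ → Bool, dataWeight P x := by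
        rw [Finset.mul_sum (Finset.univ : Finset (ι → κ → Bool)),
          Finset.mul_sum (Finset.univ : Finset (ι → κ → Bool)), ← Finset.sum_sub_distrib]
        exact Finset.sum_congr rfl fun x _ => by ring
      have := Finset.sum_le_sum fun (x : ι → κ → Bool) (_ : x ∈ Finset.univ) =>
        mul_le_mul_of_nonneg_left (pt x) (dataWeight_nonneg hP x)
      rw [e2, e1, sum_dataWeight] at this
      linarith
    have isq : ∫ P, ∑ j, P j ^ 2 ∂unifCube κ = p * (1 / 3) := by
      rw [integral_finsetSum _ fun j _ => integrable_unifCube (by fun_prop),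
        Finset.sum_congr rfl fun j _ =>
          (integral_unifCube_apply (f := fun t => t ^ 2) (by fun_prop) j).trans integral_unif_sq]
      simp [hp]
    have iabs : ∫ P, ∑ j, |P j| ∂unifCube κ = p * (1 / 2) := by
      rw [integral_finsetSum _ fun j _ => integrable_unifCube (by fun_prop),
        Finset.sum_congr rfl fun j _ =>
          (integral_unifCube_apply (f := fun t => |t|) (by fun_prop) j).trans integral_unif_abs]
      simp [hp]
    calc 37 / 1000 * p
        ≤ 4 / 3 * (p * (1 / 3)) - 2 / 3 * (p * (1 / 2)) - 2 * (p * (1 / 100) + 2 * (p / 75)) := by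
          linarith
      _ = ∫ P, (4 / 3 * ∑ j, P j ^ 2 - 2 / 3 * ∑ j, |P j|
            - 2 * (p * (1 / 100) + 2 * (p / 75))) ∂unifCube κ := by
          rw [integral_sub (integrable_unifCube (by fun_prop)) (integrable_const _),
            integral_sub (integrable_unifCube (by fun_prop)) (integrable_unifCube (by fun_prop)),
            integral_const_mul, integral_const_mul, isq, iabs]
          simp
      _ ≤ _ := by
          refine integral_mono_ae (integrable_unifCube (by fun_prop))
            (integrable_unifCube (by fun_prop)) ?_
          filter_upwards [ae_unifCube] with P hP using this P hP
  rw [score] at upper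
  linarith

end Core

/-! ### The quadratic problem, its minimizer and its excess risk -/

section Setting

variable {p n : ℕ} {μ : ℝ} {L : EuclideanSpace ℝ (Fin p)}

lemma hasGradientAt_loss (μ : ℝ) (d v : EuclideanSpace ℝ (Fin p)) :
    HasGradientAt (loss μ d) (μ • (v - d)) v := by
  rw [hasGradientAt_iff_hasFDerivAt]
  have h1 : HasFDerivAt (fun w : EuclideanSpace ℝ (Fin p) => w - d)
      (ContinuousLinearMap.id ℝ _) v := (hasFDerivAt_id v).sub_const d
  have h := (h1.norm_sq).const_mul (μ / 2)
  unfold loss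
  refine h.congr_fderiv ?_
  ext w
  simp
  ring

lemma isStronglyConvex_loss (μ : ℝ) (d : EuclideanSpace ℝ (Fin p)) :
    IsStronglyConvex μ (loss μ d) := by
  refine ⟨fun v => (hasGradientAt_loss μ d v).differentiableAt, fun v w => le_of_eq ?_⟩
  rw [(hasGradientAt_loss μ d v).gradient, loss, loss,
    show w - d = (v - d) + (w - v) by abel, norm_add_sq_real, real_inner_smul_left]
  ring

lemma loss_eq_sum (μ : ℝ) (d w : EuclideanSpace ℝ (Fin p)) :
    loss μ d w = μ / 2 * ∑ j, (w j - d j) ^ 2 := by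
  simp [loss, EuclideanSpace.norm_sq_eq]

lemma componentLipschitzOn_loss (hμ : 0 < μ) {d : EuclideanSpace ℝ (Fin p)}
    (hd : d ∈ dataUniv μ L) : ComponentLipschitzOn L (loss μ d) (box μ L) := by
  intro w hw t j hwt
  have e : loss μ d (w + EuclideanSpace.single j t) - loss μ d w
      = μ / 2 * (((w j - d j) + (w j + t - d j)) * t) := by
    rw [loss_eq_sum, loss_eq_sum, ← mul_sub, ← Finset.sum_sub_distrib, Finset.sum_eq_single j]
    · simp; left; ring
    · intro k _ hk
      simp [hk]
    · simp
  rw [e, abs_mul, abs_mul, abs_of_pos (by positivity : 0 < μ / 2)]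
  have h1 := hw j
  have h2 := hwt j
  simp only [PiLp.add_apply, PiLp.single_apply, if_true] at h2
  have h3 := hd j
  set a := L j / (2 * μ) with ha
  -- Both points and `d` lie in the box, so each difference is at most the side length `2 * a`.
  have h4 : |w j - d j + (w j + t - d j)| ≤ 4 * a := by
    obtain ⟨h1a, h1b⟩ := h1
    obtain ⟨h2a, h2b⟩ := h2
    rcases h3 with h3 | h3 <;> rw [h3] <;> exact abs_le.2 ⟨by linarith, by linarith⟩
  calc _ ≤ μ / 2 * (4 * a * |t|) := by gcongr
    _ = L j * |t| := by rw [ha]; field_simp; norm_num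

lemma charFn_box (w : EuclideanSpace ℝ (Fin p)) :
    charFn (box μ L) w = ∑ j, charFn (side μ L j) (w j) := by
  by_cases h : w ∈ box μ L
  · rw [charFn, if_pos h]
    exact (Finset.sum_eq_zero fun j _ => if_pos (h j)).symm
  · rw [charFn, if_neg h]
    have : ∃ j, w j ∉ side μ L j := by
      by_contra! hc
      exact h hc
    obtain ⟨j, hj⟩ := this
    have nonneg : ∀ k, 0 ≤ charFn (side μ L k) (w k) := fun k => by
      unfold charFn
      split_ifs <;> simp
    have := Finset.single_le_sum (fun k _ => nonneg k) (Finset.mem_univ j)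
    rw [charFn, if_neg hj] at this
    exact (top_le_iff.1 this).symm

lemma abs_dataUniv (hμ : 0 < μ) (hL : ∀ j, 0 < L j) (d : dataUniv μ L) (j : Fin p) :
    |(d : EuclideanSpace ℝ (Fin p)) j| = L j / (2 * μ) := by
  have : 0 < L j / (2 * μ) := div_pos (hL j) (by positivity)
  rcases d.2 j with h | h <;> rw [h]
  · exact abs_of_pos this
  · rw [abs_neg, abs_of_pos this]

lemma mean_apply (D : Fin n → dataUniv μ L) (j : Fin p) :
    mean D j = (1 / (n : ℝ)) * ∑ i, (D i : EuclideanSpace ℝ (Fin p)) j := by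
  simp [mean]

lemma mean_mem_box (hn : 0 < n) (hμ : 0 < μ) (hL : ∀ j, 0 < L j) (D : Fin n → dataUniv μ L) :
    mean D ∈ box μ L := by
  intro j
  have hn' : (0 : ℝ) < n := by exact_mod_cast hn
  rw [side, Set.mem_Icc, ← abs_le, mean_apply, abs_mul, abs_of_pos (by positivity)]
  calc _ ≤ 1 / (n : ℝ) * ∑ i, |(D i : EuclideanSpace ℝ (Fin p)) j| := by
        gcongr
        exact Finset.abs_sum_le_sum_abs _ _
    _ = _ := by
        simp only [abs_dataUniv hμ hL, Finset.sum_const, Finset.card_univ, Fintype.card_fin,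
          nsmul_eq_mul]
        field_simp

/-- The bias-variance decomposition of the empirical loss. -/
lemma avg_loss_eq (hn : 0 < n) (D : Fin n → dataUniv μ L) (w : EuclideanSpace ℝ (Fin p)) :
    (1 / (n : ℝ)) * ∑ i, loss μ (D i : EuclideanSpace ℝ (Fin p)) w
      = (1 / (n : ℝ)) * ∑ i, loss μ (D i : EuclideanSpace ℝ (Fin p)) (mean D)
        + loss μ (mean D) w := by
  have hn' : (n : ℝ) ≠ 0 := by exact_mod_cast hn.ne'
  have e : ∀ i, loss μ (D i : EuclideanSpace ℝ (Fin p)) w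
      = loss μ (D i : EuclideanSpace ℝ (Fin p)) (mean D) + loss μ (mean D) w
        + μ * inner ℝ (w - mean D) (mean D - (D i : EuclideanSpace ℝ (Fin p))) := fun i => by
    unfold loss
    rw [show w - (D i : EuclideanSpace ℝ (Fin p))
      = (w - mean D) + (mean D - (D i : EuclideanSpace ℝ (Fin p))) by abel, norm_add_sq_real]
    ring
  have z : ∑ i, (mean D - (D i : EuclideanSpace ℝ (Fin p))) = 0 := by
    rw [Finset.sum_sub_distrib, Finset.sum_const, Finset.card_univ, Fintype.card_fin, mean,
      ← Nat.cast_smul_eq_nsmul ℝ, smul_smul, mul_one_div_cancel hn', one_smul, sub_self]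
  simp only [e, Finset.sum_add_distrib, ← Finset.mul_sum, ← inner_sum]
  rw [z, inner_zero_right]
  simp
  field_simp

lemma objective_of_mem (D : Fin n → dataUniv μ L) {w : EuclideanSpace ℝ (Fin p)}
    (hw : w ∈ box μ L) :
    objective μ L D w
      = (((1 / (n : ℝ)) * ∑ i, loss μ (D i : EuclideanSpace ℝ (Fin p)) w : ℝ) : EReal) := by
  rw [objective, charFn, if_pos hw, add_zero]

lemma objective_of_notMem (D : Fin n → dataUniv μ L) {w : EuclideanSpace ℝ (Fin p)}
    (hw : w ∉ box μ L) : objective μ L D w = ⊤ := by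
  rw [objective, charFn, if_neg hw, EReal.coe_add_top]

lemma objective_mean_le (hn : 0 < n) (hμ : 0 < μ) (hL : ∀ j, 0 < L j) (D : Fin n → dataUniv μ L)
    (w : EuclideanSpace ℝ (Fin p)) : objective μ L D (mean D) ≤ objective μ L D w := by
  by_cases hw : w ∈ box μ L
  · rw [objective_of_mem D (mean_mem_box hn hμ hL D), objective_of_mem D hw,
      EReal.coe_le_coe_iff, avg_loss_eq hn D w]
    have : 0 ≤ loss μ (mean D) w := by unfold loss; positivity
    linarith
  · rw [objective_of_notMem D hw]
    exact le_top

lemma forall_objective_le_iff (hn : 0 < n) (hμ : 0 < μ) (hL : ∀ j, 0 < L j)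
    (D : Fin n → dataUniv μ L) (w : EuclideanSpace ℝ (Fin p)) :
    (∀ v, objective μ L D w ≤ objective μ L D v) ↔ w = mean D := by
  refine ⟨fun h => ?_, fun h v => h ▸ objective_mean_le hn hμ hL D v⟩
  have h1 := h (mean D)
  rw [objective_of_mem D (mean_mem_box hn hμ hL D)] at h1
  by_cases hw : w ∈ box μ L
  · rw [objective_of_mem D hw, EReal.coe_le_coe_iff, avg_loss_eq hn D w, loss] at h1
    have h2 : ‖w - mean D‖ ^ 2 ≤ 0 := by
      by_contra! hc
      have : 0 < μ / 2 * ‖w - mean D‖ ^ 2 := by positivity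
      linarith
    have h3 : ‖w - mean D‖ = 0 := by
      have := le_antisymm h2 (sq_nonneg _)
      exact pow_eq_zero_iff (two_ne_zero) |>.1 this
    exact sub_eq_zero.1 (norm_eq_zero.1 h3)
  · rw [objective_of_notMem D hw] at h1
    exact absurd (top_le_iff.1 h1) (EReal.coe_ne_top _)

/-- Equality holds in the box by the bias-variance decomposition, and outside it the excess risk is
infinite. The algorithm therefore need not output feasible points. -/
lemma loss_mean_le_excessRisk (hn : 0 < n) (hμ : 0 < μ) (hL : ∀ j, 0 < L j)
    (D : Fin n → dataUniv μ L) (w : EuclideanSpace ℝ (Fin p)) :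
    (loss μ (mean D) w : EReal) ≤ excessRisk μ L D w := by
  have hinf : ⨅ v, objective μ L D v = objective μ L D (mean D) :=
    le_antisymm (iInf_le _ _) (le_iInf fun v => objective_mean_le hn hμ hL D v)
  rw [excessRisk, hinf, objective_of_mem D (mean_mem_box hn hμ hL D)]
  by_cases hw : w ∈ box μ L
  · rw [objective_of_mem D hw, ← EReal.coe_sub, EReal.coe_le_coe_iff, avg_loss_eq hn D w]
    linarith
  · rw [objective_of_notMem D hw, EReal.top_sub_coe]
    exact le_top

end Setting

/-! ### Reduction to few records by padding, and the risk bounds -/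

lemma exists_subsample_size {p n : ℕ} {ε : ℝ} (hn : 0 < n) (hε : 0 < ε)
    (hεp : ε ≤ 1 / 1000 * √(p : ℝ)) :
    ∃ m : ℕ, 0 < m ∧ m ≤ n ∧ m * ε ≤ √(p : ℝ) / 1000 ∧
      min 1 (p / ((n : ℝ) ^ 2 * ε ^ 2)) ≤ 4000000 * ((m : ℝ) / n) ^ 2 := by
  have hn' : (0 : ℝ) < n := by exact_mod_cast hn
  -- The largest real sample size that the core theorem allows; the upper bound on `ε` says exactly
  -- `q ≥ 1`. Hence `⌊q⌋₊ ≥ q / 2`, and the constant below is `(2 * 1000) ^ 2`.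
  set q := √(p : ℝ) / (1000 * ε) with hq
  have hq1 : 1 ≤ q := by rw [hq, one_le_div (by positivity)]; linarith
  have hfl : (⌊q⌋₊ : ℝ) ≤ q := Nat.floor_le (by linarith)
  have hqε : q * ε = √(p : ℝ) / 1000 := by rw [hq]; field_simp
  have hfl1 : 1 ≤ ⌊q⌋₊ := Nat.one_le_floor_iff q |>.2 hq1
  rcases le_total n ⌊q⌋₊ with h | h
  · refine ⟨n, hn, le_rfl, ?_, (min_le_left _ _).trans ?_⟩
    · have : (n : ℝ) ≤ ⌊q⌋₊ := by exact_mod_cast h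
      rw [← hqε]
      exact mul_le_mul_of_nonneg_right (this.trans hfl) hε.le
    · rw [div_self hn'.ne']; norm_num
  · refine ⟨⌊q⌋₊, hfl1, h, ?_, (min_le_right _ _).trans ?_⟩
    · rw [← hqε]
      exact mul_le_mul_of_nonneg_right hfl hε.le
    · have h1 : q < ⌊q⌋₊ + 1 := Nat.lt_floor_add_one q
      have h2 : (1 : ℝ) ≤ ⌊q⌋₊ := by exact_mod_cast hfl1
      have h3 : q / 2 ≤ ⌊q⌋₊ := by linarith
      have e : (p : ℝ) / ((n : ℝ) ^ 2 * ε ^ 2) = 4000000 * (q / 2 / n) ^ 2 := by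
        rw [hq, div_pow, div_pow, div_pow, Real.sq_sqrt (Nat.cast_nonneg p)]
        field_simp
        ring
      rw [e]
      gcongr

section Reduction

variable {p : ℕ} {μ : ℝ} {L : EuclideanSpace ℝ (Fin p)}

/-- The vertex of the box with sign pattern `y`. -/
def vertex (μ : ℝ) (L : EuclideanSpace ℝ (Fin p)) (y : Fin p → Bool) : dataUniv μ L :=
  ⟨WithLp.toLp 2 fun j => sgn (y j) * (L j / (2 * μ)), fun j => by
    cases h : y j <;> simp [sgn, h]⟩

lemma vertex_apply (y : Fin p → Bool) (j : Fin p) :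
    (vertex μ L y : EuclideanSpace ℝ (Fin p)) j = sgn (y j) * (L j / (2 * μ)) := rfl

/-- The dataset with sign patterns `x`, padded with `r` copies of the all-plus vertex. -/
def padded (μ : ℝ) (L : EuclideanSpace ℝ (Fin p)) {m : ℕ} (r : ℕ) (x : Fin m → Fin p → Bool) :
    Fin (m + r) → dataUniv μ L :=
  Fin.append (fun i => vertex μ L (x i)) fun _ => vertex μ L fun _ => true

lemma neighboring_padded {m : ℕ} (r : ℕ) {x x' : Fin m → Fin p → Bool}
    (h : ∃ i, ∀ k ≠ i, x k = x' k) : Neighboring (padded μ L r x) (padded μ L r x') := by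
  obtain ⟨i, hi⟩ := h
  have key : ∀ k, padded μ L r x k ≠ padded μ L r x' k → k = Fin.castAdd r i := by
    intro k
    refine Fin.addCases (fun k hk => ?_) (fun k hk => ?_) k
    · simp only [padded, Fin.append_left] at hk
      by_contra hne
      exact hk (by rw [hi k fun hki => hne (by rw [hki])])
    · simp [padded, Fin.append_right] at hk
  intro a ha b hb
  rw [key a ha, key b hb]

lemma mean_padded {m r : ℕ} (hm : 0 < m) (x : Fin m → Fin p → Bool) (j : Fin p) :
    mean (padded μ L r x) j
      = L j / (2 * μ) * ((m * colMean x j + r) / (m + r)) := by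
  have hm' : (m : ℝ) ≠ 0 := by exact_mod_cast hm.ne'
  rw [mean_apply, Fin.sum_univ_add]
  simp only [padded, Fin.append_left, Fin.append_right, vertex_apply, sgn_true, one_mul]
  rw [← Finset.sum_mul, colMean, Fintype.card_fin, mul_div_cancel₀ _ hm']
  simp
  ring

/-- The estimate of the column means of `x` read off from an estimate `w` of the mean of
`padded μ L r x`. -/
def unpad (μ : ℝ) (L : EuclideanSpace ℝ (Fin p)) (m r : ℕ) (w : EuclideanSpace ℝ (Fin p))
    (j : Fin p) : ℝ :=
  max (-1) (min 1 (((m + r) * (w j / (L j / (2 * μ))) - r) / m))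

lemma abs_unpad_le (m r : ℕ) (w : EuclideanSpace ℝ (Fin p)) (j : Fin p) :
    |unpad μ L m r w j| ≤ 1 :=
  abs_le.2 ⟨le_max_left _ _, max_le (by norm_num) (min_le_left _ _)⟩

lemma measurable_unpad (m r : ℕ) : Measurable (unpad μ L m r) := by
  refine measurable_pi_lambda _ fun j => ?_
  have : Continuous fun w => unpad μ L m r w j := by
    unfold unpad
    simp only [div_eq_mul_inv]
    fun_prop
  exact this.measurable

/-- Before clipping, `unpad` inverts the affine map from column means of `x` to means of the padded
dataset, so errors scale exactly. Clipping to `[-1, 1]` brings the estimate no further from a column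
mean, which lies there. -/
lemma abs_unpad_sub_colMean_le {m r : ℕ} (hm : 0 < m) (hμ : 0 < μ) (hL : ∀ j, 0 < L j)
    (x : Fin m → Fin p → Bool) (w : EuclideanSpace ℝ (Fin p)) (j : Fin p) :
    |unpad μ L m r w j - colMean x j| * (L j * ((m : ℝ) / (m + r)))
      ≤ 2 * μ * |w j - mean (padded μ L r x) j| := by
  have hm' : (0 : ℝ) < m := by exact_mod_cast hm
  have hLj := hL j
  have ha : 0 < L j / (2 * μ) := by positivity
  set z := ((m + r) * (w j / (L j / (2 * μ))) - r) / m with hz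
  have clip : |unpad μ L m r w j - colMean x j| ≤ |z - colMean x j| := by
    obtain ⟨h1, h2⟩ := abs_le.1 (abs_colMean_le x j)
    rw [unpad, ← hz]
    have hp := le_abs_self (z - colMean x j)
    have hn := neg_abs_le (z - colMean x j)
    rcases le_total 1 z with h | h
    · rw [min_eq_left h, max_eq_right (by norm_num), abs_of_nonneg (by linarith)]
      linarith
    · rw [min_eq_right h]
      rcases le_total (-1) z with h' | h'
      · rw [max_eq_right h']
      · rw [max_eq_left h', abs_of_nonpos (by linarith)]
        linarith
  have e : |z - colMean x j| * (L j * ((m : ℝ) / (m + r)))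
      = 2 * μ * |w j - mean (padded μ L r x) j| := by
    have e1 : (z - colMean x j) * (L j * ((m : ℝ) / (m + r)))
        = 2 * μ * (w j - mean (padded μ L r x) j) := by
      rw [mean_padded hm, hz]
      field_simp
      ring
    rw [← abs_of_pos (by positivity : 0 < L j * ((m : ℝ) / (m + r))), ← abs_mul, e1, abs_mul,
      abs_of_pos (by positivity : 0 < 2 * μ)]
  rw [← e]
  gcongr

/-- An output that misses many column means has a large loss at the mean of the dataset. -/
lemma le_loss_of_card_badCoords {κ : ℝ} (hκ : 0 ≤ κ) (hspread : WellSpread κ L) {m r : ℕ}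
    (hm : 0 < m) (hμ : 0 < μ) (hL : ∀ j, 0 < L j) {β : ℝ} (hβ : 0 ≤ β)
    {x : Fin m → Fin p → Bool} {w : EuclideanSpace ℝ (Fin p)}
    (h : (p : ℝ) / 75 ≤ (badCoords β x (unpad μ L m r w)).card) :
    β ^ 2 * κ ^ 2 / 8 * ((m : ℝ) / (m + r)) ^ 2 * (‖L‖ ^ 2 / μ)
      ≤ loss μ (mean (padded μ L r x)) w := by
  set J := badCoords β x (unpad μ L m r w) with hJ
  set t := (m : ℝ) / (m + r) with ht
  have ht0 : 0 ≤ t := by positivity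
  have hcard : ⌈(p : ℝ) / 75⌉₊ ≤ J.card := Nat.ceil_le.2 h
  have hs : κ ^ 2 * ‖L‖ ^ 2 ≤ ∑ j ∈ J, L j ^ 2 := by
    have := pow_le_pow_left₀ (by positivity) (hspread J hcard) 2
    rwa [mul_pow, Real.sq_sqrt (Finset.sum_nonneg fun j _ => sq_nonneg _)] at this
  have hj : ∀ j ∈ J, (β * t) ^ 2 * L j ^ 2
      ≤ (2 * μ) ^ 2 * (w j - mean (padded μ L r x) j) ^ 2 := by
    intro j hjJ
    have h1 : β < |unpad μ L m r w j - colMean x j| := (Finset.mem_filter.1 hjJ).2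
    have h2 := abs_unpad_sub_colMean_le (r := r) hm hμ hL x w j
    have hLj := hL j
    have h3 : β * (L j * t) ≤ 2 * μ * |w j - mean (padded μ L r x) j| :=
      (mul_le_mul_of_nonneg_right h1.le (by positivity)).trans h2
    have h4 := pow_le_pow_left₀ (by positivity) h3 2
    rw [mul_pow (2 * μ), sq_abs] at h4
    linarith
  have h5 := Finset.sum_le_sum hj
  rw [← Finset.mul_sum, ← Finset.mul_sum] at h5
  have h6 : ∑ j ∈ J, (w j - mean (padded μ L r x) j) ^ 2
      ≤ ∑ j, (w j - mean (padded μ L r x) j) ^ 2 :=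
    Finset.sum_le_sum_of_subset_of_nonneg (Finset.subset_univ _) fun j _ _ => sq_nonneg _
  rw [loss_eq_sum]
  calc β ^ 2 * κ ^ 2 / 8 * t ^ 2 * (‖L‖ ^ 2 / μ)
      = 1 / (8 * μ) * ((β * t) ^ 2 * (κ ^ 2 * ‖L‖ ^ 2)) := by field_simp
    _ ≤ 1 / (8 * μ) * ((β * t) ^ 2 * ∑ j ∈ J, L j ^ 2) := by gcongr
    _ ≤ 1 / (8 * μ) *
        ((2 * μ) ^ 2 * ∑ j ∈ J, (w j - mean (padded μ L r x) j) ^ 2) := by gcongr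
    _ ≤ 1 / (8 * μ) * ((2 * μ) ^ 2 * ∑ j, (w j - mean (padded μ L r x) j) ^ 2) := by gcongr
    _ = _ := by field_simp; norm_num

lemma rate_eq (n : ℕ) (μ : ℝ) (hμ : 0 < μ) (L : EuclideanSpace ℝ (Fin p)) (ε : ℝ) :
    rate n μ L ε = min 1 (p / ((n : ℝ) ^ 2 * ε ^ 2)) * (‖L‖ ^ 2 / μ) := by
  rw [rate, min_mul_of_nonneg _ _ (by positivity), one_mul]
  congr 1
  rw [div_mul_div_comm]
  congr 1
  ring

/-- The risk lower bound for a private algorithm, with an explicit constant. -/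
theorem riskAtLeast_of_wellSpread {κ : ℝ} (hκ : 0 ≤ κ) {n : ℕ} (hp : 0 < p) (hn : 0 < n)
    {ε δ : ℝ} (hμ : 0 < μ) (hL : ∀ j, 0 < L j) (hspread : WellSpread κ L) (hε : 0 < ε)
    (hεp : ε ≤ 1 / 1000 * √(p : ℝ)) (hδ : 0 ≤ δ) (hδn : δ ≤ 1 / 1000 / n)
    (A : (Fin n → dataUniv μ L) → ProbabilityMeasure (EuclideanSpace ℝ (Fin p)))
    (hA : IsDP A ε δ) :
    RiskAtLeast μ L A (κ ^ 2 / 10 ^ 12 * rate n μ L ε) := by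
  obtain ⟨m, hm, hmn, hmε, hrate⟩ := exists_subsample_size hn hε hεp
  obtain ⟨r, rfl⟩ := Nat.exists_eq_add_of_le hmn
  have hm' : (0 : ℝ) < m := by exact_mod_cast hm
  have hnδ : ((m + r : ℕ) : ℝ) * δ ≤ 1 / 1000 := by
    have := (le_div_iff₀' (by exact_mod_cast hn)).1 hδn
    exact this
  have hmδ : (m : ℝ) * δ ≤ 1 / 1000 := by
    refine le_trans ?_ hnδ
    exact mul_le_mul_of_nonneg_right (by exact_mod_cast hmn) hδ
  have : Nonempty (Fin m) := ⟨⟨0, hm⟩⟩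
  have : Nonempty (Fin p) := ⟨⟨0, hp⟩⟩
  obtain ⟨x, hx⟩ := exists_measure_badCoords_ge
    (fun x : Fin m → Fin p → Bool => (A (padded μ L r x) : Measure (EuclideanSpace ℝ (Fin p))))
    hε hδ (by simpa using hmε) (by simpa using hmδ)
    (fun x x' h => hA _ _ (neighboring_padded r h)) (measurable_unpad (μ := μ) (L := L) m r)
    (abs_unpad_le m r)
  rw [Fintype.card_fin] at hx
  set D := padded μ L r x with hD
  set S := {w | (p : ℝ) / 75 ≤ ((badCoords (1 / 100) x (unpad μ L m r w)).card : ℝ)} with hS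
  have hSm : MeasurableSet S := measurableSet_badCoords (measurable_unpad m r) _ _ x
  set ρ := κ ^ 2 / 10 ^ 12 * rate (m + r) μ L ε with hρ
  have hρ0 : 0 ≤ ρ := by
    rw [hρ, rate_eq _ _ hμ]
    positivity
  -- The factor `3` pays for the probability `1 / 3` of `S` in the bound on the expectation. The
  -- constant `10 ^ 12` suffices because `3 * 4000000 / 10 ^ 12` is below `(1 / 100) ^ 2 / 8 = 1 /
  -- 80000`.
  have hbig : ∀ w ∈ S, ((3 * ρ : ℝ) : EReal) ≤ excessRisk μ L D w := by
    intro w hw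
    refine le_trans ?_ (loss_mean_le_excessRisk hn hμ hL D w)
    rw [EReal.coe_le_coe_iff]
    refine le_trans ?_ (le_loss_of_card_badCoords hκ hspread hm hμ hL (by norm_num) hw)
    rw [hρ, rate_eq _ _ hμ]
    push_cast at hrate ⊢
    calc _ = 3 * κ ^ 2 / 10 ^ 12 * (‖L‖ ^ 2 / μ)
          * min 1 (p / (((m : ℝ) + r) ^ 2 * ε ^ 2)) := by ring
      _ ≤ 3 * κ ^ 2 / 10 ^ 12 * (‖L‖ ^ 2 / μ) * (4000000 * ((m : ℝ) / (m + r)) ^ 2) := by gcongr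
      _ = 12 / 10 ^ 6 * (κ ^ 2 * (‖L‖ ^ 2 / μ) * ((m : ℝ) / (m + r)) ^ 2) := by ring
      _ ≤ 1 / 80000 * (κ ^ 2 * (‖L‖ ^ 2 / μ) * ((m : ℝ) / (m + r)) ^ 2) := by
          exact mul_le_mul_of_nonneg_right (by norm_num) (by positivity)
      _ = _ := by ring
  refine ⟨D, hx.trans (measure_mono fun w hw => le_trans ?_ (hbig w hw)), ?_⟩
  · rw [EReal.coe_le_coe_iff]
    linarith
  · calc ENNReal.ofReal ρ = ENNReal.ofReal (3 * ρ) * (1 / 3) := by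
          rw [ENNReal.ofReal_mul (p := 3) (by norm_num), mul_right_comm,
            show ENNReal.ofReal 3 = 3 by simp, one_div,
            ENNReal.mul_inv_cancel (by norm_num) (by norm_num), one_mul]
      _ ≤ ENNReal.ofReal (3 * ρ) * (A D : Measure (EuclideanSpace ℝ (Fin p))) S := by
          gcongr
      _ = ∫⁻ _w in S, ENNReal.ofReal (3 * ρ) ∂(A D : Measure (EuclideanSpace ℝ (Fin p))) := by
          rw [setLIntegral_const]
      _ ≤ ∫⁻ w in S, (excessRisk μ L D w).toENNReal
            ∂(A D : Measure (EuclideanSpace ℝ (Fin p))) := by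
          refine setLIntegral_mono' hSm fun w hw => ?_
          have := EReal.toENNReal_le_toENNReal (hbig w hw)
          rwa [EReal.toENNReal_of_ne_top (EReal.coe_ne_top _), EReal.toReal_coe] at this
      _ ≤ _ := setLIntegral_le_lintegral _ _

/-- At least `p / 75` coordinates carry squared mass at least `(p / 75) * (⨅ j, L j) ^ 2`, while
`‖L‖ ^ 2 ≤ p * (⨆ j, L j) ^ 2`. -/
lemma wellSpread_iInf_div_iSup (hp : 0 < p) (hL : ∀ j, 0 < L j) :
    WellSpread ((⨅ j, L j) / (⨆ j, L j) / √75) L := by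
  have : Nonempty (Fin p) := ⟨⟨0, hp⟩⟩
  intro J hJ
  set a := ⨅ j, L j with ha
  set b := ⨆ j, L j with hb
  have hle : ∀ j, L j ≤ b := fun j => le_ciSup (Set.finite_range _).bddAbove j
  have hge : ∀ j, a ≤ L j := fun j => ciInf_le (Set.finite_range _).bddBelow j
  have hb0 : 0 < b := (hL ⟨0, hp⟩).trans_le (hle _)
  have ha0 : 0 ≤ a := le_ciInf fun j => (hL j).le
  have hcard : (p : ℝ) / 75 ≤ J.card := Nat.ceil_le.1 hJ
  refine Real.le_sqrt_of_sq_le ?_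
  have h1 : ‖L‖ ^ 2 ≤ p * b ^ 2 := by
    rw [EuclideanSpace.norm_sq_eq]
    calc _ ≤ ∑ _j : Fin p, b ^ 2 := Finset.sum_le_sum fun j _ => by
          rw [Real.norm_eq_abs, sq_abs]
          exact pow_le_pow_left₀ (hL j).le (hle j) 2
      _ = _ := by simp
  rw [mul_pow, div_pow, div_pow, Real.sq_sqrt (by norm_num)]
  calc a ^ 2 / b ^ 2 / 75 * ‖L‖ ^ 2 ≤ a ^ 2 / b ^ 2 / 75 * (p * b ^ 2) := by gcongr
    _ = p / 75 * a ^ 2 := by field_simp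
    _ ≤ J.card * a ^ 2 := by gcongr
    _ = ∑ _j ∈ J, a ^ 2 := by simp
    _ ≤ ∑ j ∈ J, L j ^ 2 := Finset.sum_le_sum fun j _ => pow_le_pow_left₀ ha0 (hge j) 2

end Reduction

end DPLower

end

theorem mainTheorem4 :
    -- the problem fits the setting, and its unique minimizer is the mean of the data
    (∀ (p n : ℕ), 0 < p → 0 < n → ∀ (μ : ℝ) (L : EuclideanSpace ℝ (Fin p)),
      0 < μ → (∀ j, 0 < L j) →
        (∀ d ∈ DPLower.dataUniv μ L,
          DPLower.IsStronglyConvex μ (DPLower.loss μ d) ∧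
          DPLower.ComponentLipschitzOn L (DPLower.loss μ d) (DPLower.box μ L)) ∧
        (∀ w : EuclideanSpace ℝ (Fin p),
          DPLower.charFn (DPLower.box μ L) w = ∑ j, DPLower.charFn (DPLower.side μ L j) (w j)) ∧
        (∀ D : Fin n → DPLower.dataUniv μ L,
          DPLower.mean D ∈ DPLower.box μ L ∧
          ∀ w, (∀ v, DPLower.objective μ L D w ≤ DPLower.objective μ L D v) ↔
            w = DPLower.mean D)) ∧
    -- the lower bounds
    ∃ c₀ : ℝ, 0 < c₀ ∧ ∃ c₁ : ℝ, 0 < c₁ ∧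
      (∀ κ : ℝ, 0 < κ → ∃ c : ℝ, 0 < c ∧
        ∀ (p n : ℕ), 0 < p → 0 < n → ∀ (μ : ℝ) (L : EuclideanSpace ℝ (Fin p)) (ε δ : ℝ),
          0 < μ → (∀ j, 0 < L j) → DPLower.WellSpread κ L →
          0 < ε → ε ≤ c₁ * √(p : ℝ) → 0 ≤ δ → δ ≤ c₀ / n →
          ∀ A : (Fin n → DPLower.dataUniv μ L) → ProbabilityMeasure (EuclideanSpace ℝ (Fin p)),
            DPLower.IsDP A ε δ →
            DPLower.RiskAtLeast μ L A (c * DPLower.rate n μ L ε)) ∧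
      (∃ c : ℝ, 0 < c ∧
        ∀ (p n : ℕ), 0 < p → 0 < n → ∀ (μ : ℝ) (L : EuclideanSpace ℝ (Fin p)) (ε δ : ℝ),
          0 < μ → (∀ j, 0 < L j) →
          0 < ε → ε ≤ c₁ * √(p : ℝ) → 0 ≤ δ → δ ≤ c₀ / n →
          ∀ A : (Fin n → DPLower.dataUniv μ L) → ProbabilityMeasure (EuclideanSpace ℝ (Fin p)),
            DPLower.IsDP A ε δ →
            DPLower.RiskAtLeast μ L A
              (c * (((⨅ j, L j) / (⨆ j, L j)) ^ 2 * DPLower.rate n μ L ε))) := by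
  refine ⟨fun p n _ hn μ L hμ hL => ⟨fun d hd => ⟨DPLower.isStronglyConvex_loss μ d,
      DPLower.componentLipschitzOn_loss hμ hd⟩, DPLower.charFn_box, fun D =>
      ⟨DPLower.mean_mem_box hn hμ hL D, DPLower.forall_objective_le_iff hn hμ hL D⟩⟩,
    1 / 1000, by norm_num, 1 / 1000, by norm_num, fun κ hκ => ⟨κ ^ 2 / 10 ^ 12, by positivity, ?_⟩,
    -- The general bound is the well-spread one with `κ` equal to the ratio of extreme entries
    -- divided by `√75`; squaring `κ` produces the `1 / 75`.
    1 / 75 / 10 ^ 12, by positivity, ?_⟩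
  · intro p n hp hn μ L ε δ hμ hL hspread hε hεp hδ hδn A hA
    exact DPLower.riskAtLeast_of_wellSpread hκ.le hp hn hμ hL hspread hε hεp hδ hδn A hA
  · intro p n hp hn μ L ε δ hμ hL hε hεp hδ hδn A hA
    have hnonneg : 0 ≤ (⨅ j, L j) / (⨆ j, L j) / √75 :=
      div_nonneg (div_nonneg (Real.iInf_nonneg fun j => (hL j).le)
        (Real.iSup_nonneg fun j => (hL j).le)) (Real.sqrt_nonneg _)
    have := DPLower.riskAtLeast_of_wellSpread hnonneg hp hn hμ hL
      (DPLower.wellSpread_iInf_div_iSup hp hL) hε hεp hδ hδn A hA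
    rw [div_pow _ √75, Real.sq_sqrt (by norm_num)] at this
    convert this using 1
    ring
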